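/- Let $\mathbb{G}$ be a Carnot group of step $r$, i.e. a connected, simply connected nilpotent Lie group whose Lie algebra has a stratification $\mathfrak g=V^1\oplus\cdots\oplus V^r$ with $[V^1,V^j]=V^{j+1}$ for $1\le j<r$ and $[V^j,V^r]=0$ for all $j$. Use exponential coordinates $x=(x_{i,k})$, $1\le k\le r$, $1\le i\le m_k=\dim V^k$, adapted to the stratification, so that $\mathbb{G}\times\mathbb{R}=\mathbb{R}^{n+1}$; let $|E|$ denote the Lebesgue measure of $E\subset\mathbb{R}^{n+1}$. Let $|x|$ be the gauge norm, $|x|^{2\,r!}=\sum_{k=1}^r\sum_{i=1}^{m_k}|x_{i,k}|^{2\,r!/k}$, and put $$d(x,y)=|xy^{-1}|,\qquad d_p\big((x,t),(y,s)\big)=\big(d(x,y)^2+|t-s|\big)^{1/2},$$ $$\mathcal Q_\rho(x,t)=\{(z,\tau): |t-\tau|<\rho^2,\ d(x,z)<\rho\},$$ and let $\operatorname{diam}$ be the diameter with respect to $d_p$. Let $\Omega\subset\mathbb{G}\times\mathbb{R}$ be open and $R_0\in(0,\infty]$. All radii $\rho$ below range over $0<\rho<\min\{R_0,\operatorname{diam}\Omega\}$.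 * $\Omega$ has the A-property with constant $A>0$ (at these radii) if $|\mathcal Q_\rho(a)\cap\Omega|\ge A\,|\mathcal Q_\rho(a)|$ for all $a\in\Omega$ and all such $\rho$. * For $1\le p\le\infty$ and $0<\alpha<1$, $C^\alpha_{p,0}(\Omega)$ is the set of $u\in L^p_{loc}(\Omega)$ with $$[u]_{p,\alpha,0}=\sup_{a\in\Omega}\ \sup_{\rho}\ \inf_{c\in\mathbb{R}}\ \rho^{-\alpha}\Big(\frac1{|\mathcal Q_\rho(a)\cap\Omega|}\int_{\mathcal Q_\rho(a)\cap\Omega}|u-c|^p\Big)^{1/p}<\infty$$ (with the $L^\infty$ norm if $p=\infty$). * $\Gamma^\alpha(\Omega)$ is the set of $f:\Omega\to\mathbb{R}$ for which there is a constant $C<\infty$ with $|f(a)-f(b)|\le C\,d_p(a,b)^\alpha$ for all $a,b\in\Omega$. **Proposition.** For all $\mathbb{G}$, $1\le p\le\infty$, $0<\alpha<1$ and $A>0$ there are constants $\kappa>0$ and $C\geq 0$, depending only on $\mathbb{G},p,\alpha,A$, such that the following holds for all $R_0\in(0,\infty]$ and all open $\Omega\subset\mathbb{G}\times\mathbb{R}$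 that have the A-property with constant $A$ at the radii $0<\rho<\min\{R_0,\operatorname{diam}\Omega\}$. Every $u\in C^\alpha_{p,0}(\Omega)$ agrees almost everywhere in $\Omega$ with a function $v$ such that: 1. if $R_0=\infty$ or $\Omega$ is bounded (that is, $\operatorname{diam}\Omega<\infty$), then $v\in\Gamma^\alpha(\Omega)$; so $C^\alpha_{p,0}(\Omega)\subset\Gamma^\alpha(\Omega)$; 2. $|v(a)-v(b)|\le C\,[u]_{p,\alpha,0}\,d_p(a,b)^\alpha$ for all $a,b\in\Omega$ with $d_p(a,b)<\kappa R_0$; in particular for all $a,b\in\Omega$ if $R_0=\infty$. -/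

import Mathlib

open MeasureTheory Set
open scoped ENNReal NNReal ContDiff Nat

noncomputable section

/-- Coordinates `x = (x_{i,k})` on `ℝⁿ`, split into `r` blocks, the block `k : Fin r` (the layer of
degree `k + 1`) having `m k` entries. The instance `volume` on this type is Lebesgue measure. -/
abbrev Coord {r : ℕ} (m : Fin r → ℕ) : Type := (k : Fin r) → Fin (m k) → ℝ

/-- The coordinate subspace `V^k`, for `k ≥ 1`; it is zero for `k > r`. -/
def layer {r : ℕ} (m : Fin r → ℕ) (k : ℕ) : Submodule ℝ (Coord m) where
  carrier := {v | ∀ j : Fin r, (j : ℕ) + 1 ≠ k → v j = 0}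
  add_mem' := by
    intro a b ha hb j hj
    simp [ha j hj, hb j hj]
  zero_mem' := by
    intro j _
    rfl
  smul_mem' := by
    intro c a ha j hj
    simp [ha j hj]

/-- The left-invariant vector field of a product `mul` on `ℝⁿ` with value `v` at the identity `0`:
`X_v(x) = d/ds mul x (s v)` at `s = 0`. -/
def leftInvField {r : ℕ} {m : Fin r → ℕ} (mul : Coord m → Coord m → Coord m) (v : Coord m) :
    Coord m → Coord m :=
  fun x => fderiv ℝ (mul x) 0 v

/-- The Lie bracket of the Lie algebra of left-invariant vector fields, each field being identified
with its value at `0`. -/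
def leftInvBracket {r : ℕ} {m : Fin r → ℕ} (mul : Coord m → Coord m → Coord m)
    (v w : Coord m) : Coord m :=
  VectorField.lieBracket ℝ (leftInvField mul v) (leftInvField mul w) 0

/-- A Carnot group of step `r` with layers of dimensions `m`, written in exponential coordinates
(canonical coordinates of the first kind) for a basis adapted to the stratification: a smooth group
law on the connected and simply connected manifold `ℝⁿ` for which the lines `s ↦ s x` are the
one-parameter subgroups, and whose Lie algebra is stratified, `𝔤 = V^1 ⊕ ⋯ ⊕ V^r` with
`[V^1, V^k] = V^{k+1}` and `[V^j, V^r] = 0`. The identity is `0` and the inverse of `x` is `-x`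
(see the lemmas below). -/
structure CarnotGroup {r : ℕ} (m : Fin r → ℕ) where
  mul : Coord m → Coord m → Coord m
  contDiff_mul : ContDiff ℝ ∞ (fun q : Coord m × Coord m => mul q.1 q.2)
  mul_assoc : ∀ x y z, mul (mul x y) z = mul x (mul y z)
  smul_mul_smul : ∀ (s t : ℝ) (x : Coord m), mul (s • x) (t • x) = (s + t) • x
  span_bracket : ∀ k : ℕ, 1 ≤ k →
    Submodule.span ℝ {z | ∃ v ∈ layer m 1, ∃ w ∈ layer m k, leftInvBracket mul v w = z} =
      layer m (k + 1)
  bracket_last : ∀ j : ℕ, 1 ≤ j → j ≤ r → ∀ v ∈ layer m j, ∀ w ∈ layer m r,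
    leftInvBracket mul v w = 0

namespace CarnotGroup

variable {r : ℕ} {m : Fin r → ℕ}

theorem mul_zero (G : CarnotGroup m) (x : Coord m) : G.mul x 0 = x := by
  simpa using G.smul_mul_smul 1 0 x

theorem zero_mul (G : CarnotGroup m) (x : Coord m) : G.mul 0 x = x := by
  simpa using G.smul_mul_smul 0 1 x

theorem mul_neg_self (G : CarnotGroup m) (x : Coord m) : G.mul x (-x) = 0 := by
  simpa using G.smul_mul_smul 1 (-1) x

theorem neg_mul_self (G : CarnotGroup m) (x : Coord m) : G.mul (-x) x = 0 := by
  simpa using G.smul_mul_smul (-1) 1 x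

/-- The gauge norm: `|x|^{2 r!} = ∑_k ∑_i |x_{i,k}|^{2 r!/k}`. -/
def gauge (x : Coord m) : ℝ :=
  (∑ k : Fin r, ∑ i : Fin (m k), |x k i| ^ ((2 * (r ! : ℝ)) / ((k : ℝ) + 1))) ^
    (1 / (2 * (r ! : ℝ)))

/-- The gauge distance `d(x, y) = |x y⁻¹|`. -/
def dist (G : CarnotGroup m) (x y : Coord m) : ℝ := gauge (G.mul x (-y))

/-- The parabolic distance `(d(x, y)² + |t - s|)^{1/2}` on `𝔾 × ℝ`. -/
def pdist (G : CarnotGroup m) (a b : Coord m × ℝ) : ℝ :=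
  Real.sqrt (G.dist a.1 b.1 ^ 2 + |a.2 - b.2|)

/-- The parabolic cylinder of radius `ρ` about `a`. -/
def cylinder (G : CarnotGroup m) (ρ : ℝ) (a : Coord m × ℝ) : Set (Coord m × ℝ) :=
  {b | |a.2 - b.2| < ρ ^ 2 ∧ G.dist a.1 b.1 < ρ}

/-- The diameter with respect to the parabolic distance. -/
def pdiam (G : CarnotGroup m) (Ω : Set (Coord m × ℝ)) : ℝ≥0∞ :=
  ⨆ a ∈ Ω, ⨆ b ∈ Ω, ENNReal.ofReal (G.pdist a b)

/-- The radii in use: `0 < ρ < min {R₀, diam Ω}`, where `R₀ = ∞` is allowed. -/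
def radii (G : CarnotGroup m) (R₀ : ℝ≥0∞) (Ω : Set (Coord m × ℝ)) : Set ℝ :=
  {ρ | 0 < ρ ∧ ENNReal.ofReal ρ < min R₀ (G.pdiam Ω)}

/-- The A-property with constant `A`, at the points of `Ω` and the radii below
`min {R₀, diam Ω}`. -/
def HasAProperty (G : CarnotGroup m) (R₀ : ℝ≥0∞) (A : ℝ) (Ω : Set (Coord m × ℝ)) : Prop :=
  ∀ a ∈ Ω, ∀ ρ ∈ G.radii R₀ Ω,
    ENNReal.ofReal A * volume (G.cylinder ρ a) ≤ volume (G.cylinder ρ a ∩ Ω)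

/-- The pointwise Campanato seminorm of degree `0` at `a`: the supremum over the radii `ρ` of the
infimum over the polynomials of degree `0`, that is the constants `c`, of
`ρ^{-α} (|Q_ρ(a) ∩ Ω|⁻¹ ∫_{Q_ρ(a) ∩ Ω} |u - c|^p)^{1/p}`
(the essential supremum of `|u - c|` over `Q_ρ(a) ∩ Ω` if `p = ∞`). -/
def campanatoSeminormAt (G : CarnotGroup m) (R₀ p : ℝ≥0∞) (α : ℝ) (Ω : Set (Coord m × ℝ))
    (u : Coord m × ℝ → ℝ) (a : Coord m × ℝ) : ℝ≥0∞ :=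
  ⨆ ρ ∈ G.radii R₀ Ω, ⨅ c : ℝ, ENNReal.ofReal (ρ ^ (-α)) *
    eLpNorm (fun b => u b - c) p
      ((volume (G.cylinder ρ a ∩ Ω))⁻¹ • volume.restrict (G.cylinder ρ a ∩ Ω))

/-- The Campanato seminorm of degree `0` on `Ω`. -/
def campanatoSeminorm (G : CarnotGroup m) (R₀ p : ℝ≥0∞) (α : ℝ) (Ω : Set (Coord m × ℝ))
    (u : Coord m × ℝ → ℝ) : ℝ≥0∞ :=
  ⨆ a ∈ Ω, G.campanatoSeminormAt R₀ p α Ω u a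

/-- The Campanato class of degree `0` on `Ω`: functions in `L^p_loc(Ω)` of finite seminorm. Only
the values of `u` on `Ω` matter. -/
def MemCampanato (G : CarnotGroup m) (R₀ p : ℝ≥0∞) (α : ℝ) (Ω : Set (Coord m × ℝ))
    (u : Coord m × ℝ → ℝ) : Prop :=
  (∀ K ⊆ Ω, IsCompact K → MemLp u p (volume.restrict K)) ∧
    G.campanatoSeminorm R₀ p α Ω u < ⊤

/-- The pointwise Hölder seminorm at `a`. -/
def holderSeminormAt (G : CarnotGroup m) (α : ℝ) (Ω : Set (Coord m × ℝ))
    (f : Coord m × ℝ → ℝ) (a : Coord m × ℝ) : ℝ≥0∞ :=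
  ⨆ b ∈ Ω, ⨆ _ : b ≠ a, ENNReal.ofReal (|f b - f a| / G.pdist b a ^ α)

/-- The parabolic Hölder space on `Ω`: the pointwise seminorms at the points of `Ω` are bounded by
one finite constant. -/
def MemHolder (G : CarnotGroup m) (α : ℝ) (Ω : Set (Coord m × ℝ))
    (f : Coord m × ℝ → ℝ) : Prop :=
  ∃ C : ℝ≥0, ∀ a ∈ Ω, G.holderSeminormAt α Ω f a ≤ C

end CarnotGroup

end

/-!
A function whose mean oscillation over parabolic cylinders decays like `ρ ^ α` is Hölder continuous.
There are two parts.

*Geometry.* The argument needs only that the gauge is a homogeneous quasi-norm and that the volume of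
a cylinder is independent of its centre and scales by a fixed factor with its radius. Both follow once
the dilations are known to be group automorphisms. The stratification and the Jacobi identity
(`bracket_mem_layer`) make them automorphisms of the Lie algebra. In exponential coordinates the
Maurer-Cartan form `N` satisfies `d/ds (N(sx) s w) = w - [x, N(sx) s w]`, which follows from the
structure equation `[X_v, X_w] = X_{[v, w]}` and `X_x(s x) = x` (`hasDerivAt_coframe_smul`). By
uniqueness for this linear equation an automorphism of the Lie algebra preserves the left-invariant
frame (`map_frame`), hence maps integral curves to integral curves and so is an automorphism of the
group (`map_mul_of_map_bracket`). The determinant of the frame is then constant along dilations, which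
shrink every point to the identity, so it is `1` (`det_frame`) and Lebesgue measure is invariant under
left translations; being invariant under the inversion `x ↦ -x`, it is invariant under right
translations too. Compactness of the unit gauge ball gives the quasi-triangle inequality
(`exists_gauge_mul_le`).

*Analysis.* By the A-property, the means of `u` over two comparable nested cylinders differ by at most
a multiple of `[u] ρ ^ α` (`HasMeanOscillation.abs_mean_sub_mean_le`), so along radii `2⁻ⁿ ρ` they
converge geometrically to a value `v a`. With `K` the quasi-triangle constant, two points at distance
`d` with `2 K d < R₀` are compared through the cylinder of radius `2 K d` about one of them. When
`2 K d` is at least the diameter of `Ω` this radius is not available; then a cylinder of radius just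
below the diameter about any point of `Ω` contains almost all of `Ω`
(`eventually_lt_volume_cylinder_inter`), and the means over two such cylinders are compared through
their intersection. That `v = u` almost everywhere needs no differentiation theorem: `v` is continuous
and the means of `|u - v|` over small cylinders tend to zero uniformly, so its integral vanishes by
Fubini's theorem and Fatou's lemma (`ae_eq_zero_of_setLIntegral_cylinder_le`). If `Ω` has finite
diameter it is relatively compact, so `v` is bounded and its local Hölder bound becomes global.
-/

open Filter Topology

noncomputable section

namespace CarnotGroup

variable {r : ℕ} {m : Fin r → ℕ}

/-! ### The left-invariant frame -/

/-- The derivative at `0` of the left translation by `x`: its columns are the values at `x` of a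
basis of left-invariant fields. -/
def frame (G : CarnotGroup m) (x : Coord m) : Coord m →L[ℝ] Coord m := fderiv ℝ (G.mul x) 0

/-- The derivative at `x` of the left translation by `-x`: the Maurer-Cartan form, inverse to
`frame`. -/
def coframe (G : CarnotGroup m) (x : Coord m) : Coord m →L[ℝ] Coord m := fderiv ℝ (G.mul (-x)) x

theorem leftInvField_eq (G : CarnotGroup m) (v x : Coord m) :
    leftInvField G.mul v x = G.frame x v := rfl

theorem contDiff_mul_left (G : CarnotGroup m) (x : Coord m) : ContDiff ℝ ∞ (G.mul x) :=
  G.contDiff_mul.comp (contDiff_const.prodMk contDiff_id)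

theorem hasFDerivAt_mul_left (G : CarnotGroup m) (x y : Coord m) :
    HasFDerivAt (G.mul x) (fderiv ℝ (G.mul x) y) y :=
  ((G.contDiff_mul_left x).differentiable (by simp) y).hasFDerivAt

theorem contDiff_frame (G : CarnotGroup m) : ContDiff ℝ ∞ G.frame :=
  ContDiff.fderiv (f := G.mul) (n := ∞) (m := ∞) G.contDiff_mul contDiff_const (by simp)

theorem contDiff_coframe (G : CarnotGroup m) : ContDiff ℝ ∞ G.coframe :=
  ContDiff.fderiv (f := fun x y => G.mul (-x) y) (n := ∞) (m := ∞)
    (G.contDiff_mul.comp ((contDiff_fst.neg).prodMk contDiff_snd)) contDiff_id (by simp)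

theorem hasFDerivAt_frame (G : CarnotGroup m) (x : Coord m) :
    HasFDerivAt G.frame (fderiv ℝ G.frame x) x :=
  (G.contDiff_frame.differentiable (by simp) x).hasFDerivAt

theorem neg_mul_cancel_left (G : CarnotGroup m) (x y : Coord m) :
    G.mul (-x) (G.mul x y) = y := by
  rw [← G.mul_assoc, G.neg_mul_self, G.zero_mul]

theorem mul_neg_cancel_right (G : CarnotGroup m) (x y : Coord m) :
    G.mul (G.mul x y) (-y) = x := by
  rw [G.mul_assoc, G.mul_neg_self, G.mul_zero]

theorem neg_mul_cancel_right (G : CarnotGroup m) (x y : Coord m) :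
    G.mul (G.mul x (-y)) y = x := by
  rw [G.mul_assoc, G.neg_mul_self, G.mul_zero]

theorem neg_mul_rev (G : CarnotGroup m) (x y : Coord m) :
    -(G.mul x y) = G.mul (-y) (-x) := by
  have h : G.mul (-(G.mul x y)) (G.mul x y) = 0 := G.neg_mul_self _
  calc -(G.mul x y) = G.mul (G.mul (G.mul (-(G.mul x y)) (G.mul x y)) (-y)) (-x) := by
        rw [← G.mul_assoc (-(G.mul x y)), mul_neg_cancel_right, mul_neg_cancel_right]
    _ = G.mul (-y) (-x) := by rw [h, G.zero_mul]

theorem fderiv_mul_left_comp (G : CarnotGroup m) (x y : Coord m) :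
    (fderiv ℝ (G.mul (-x)) (G.mul x y)).comp (fderiv ℝ (G.mul x) y) =
      ContinuousLinearMap.id ℝ (Coord m) := by
  have h := (G.hasFDerivAt_mul_left (-x) (G.mul x y)).comp y (G.hasFDerivAt_mul_left x y)
  have h2 : G.mul (-x) ∘ G.mul x = id := by
    ext1 z
    exact G.neg_mul_cancel_left x z
  rw [h2] at h
  exact h.unique (hasFDerivAt_id y)

theorem isInvertible_fderiv_mul_left (G : CarnotGroup m) (x y : Coord m) :
    (fderiv ℝ (G.mul x) y).IsInvertible := by
  refine ContinuousLinearMap.IsInvertible.of_inverse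
    (g := fderiv ℝ (G.mul (-x)) (G.mul x y)) ?_ (G.fderiv_mul_left_comp x y)
  have := G.fderiv_mul_left_comp (-x) (G.mul x y)
  rwa [neg_neg, G.neg_mul_cancel_left] at this

theorem coframe_frame (G : CarnotGroup m) (x v : Coord m) : G.coframe x (G.frame x v) = v := by
  have h := G.fderiv_mul_left_comp x 0
  rw [G.mul_zero] at h
  exact congrArg (fun L => L v) h

theorem frame_coframe (G : CarnotGroup m) (x v : Coord m) : G.frame x (G.coframe x v) = v := by
  have h := G.fderiv_mul_left_comp (-x) x
  rw [neg_neg, G.neg_mul_self] at h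
  exact congrArg (fun L => L v) h

theorem frame_zero (G : CarnotGroup m) : G.frame 0 = ContinuousLinearMap.id ℝ (Coord m) := by
  have h : G.mul 0 = id := by
    ext1 z
    exact G.zero_mul z
  rw [frame, h, fderiv_id]

/-- Left-invariance of the fields `X_v`. -/
theorem frame_mul (G : CarnotGroup m) (x y : Coord m) :
    G.frame (G.mul x y) = (fderiv ℝ (G.mul x) y).comp (G.frame y) := by
  have h1 := G.hasFDerivAt_mul_left (G.mul x y) 0
  have h2 := (G.hasFDerivAt_mul_left x (G.mul y 0)).comp 0 (G.hasFDerivAt_mul_left y 0)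
  have h3 : G.mul x ∘ G.mul y = G.mul (G.mul x y) := by
    ext1 z
    exact (G.mul_assoc x y z).symm
  rw [h3, G.mul_zero] at h2
  exact h1.unique h2

theorem hasDerivAt_mul_smul (G : CarnotGroup m) (x y : Coord m) (s : ℝ) :
    HasDerivAt (fun t : ℝ => G.mul x (t • y)) (fderiv ℝ (G.mul x) (s • y) y) s := by
  have h : HasDerivAt (fun t : ℝ => t • y) y s := by
    simpa using (hasDerivAt_id s).smul_const y
  exact (G.hasFDerivAt_mul_left x (s • y)).comp_hasDerivAt s h

/-- The line `s ↦ s x` is an integral curve of `X_x`. -/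
theorem frame_smul_self (G : CarnotGroup m) (s : ℝ) (x : Coord m) : G.frame (s • x) x = x := by
  have h1 := G.hasDerivAt_mul_smul (s • x) x 0
  simp only [G.smul_mul_smul, zero_smul] at h1
  have h2 : HasDerivAt (fun t : ℝ => (s + t) • x) x 0 := by
    simpa using ((hasDerivAt_id (0 : ℝ)).const_add s).smul_const x
  exact h1.unique h2

theorem fderiv_mul_left_smul_self (G : CarnotGroup m) (x y : Coord m) (s : ℝ) :
    fderiv ℝ (G.mul x) (s • y) y = G.frame (G.mul x (s • y)) y := by
  rw [frame_mul, ContinuousLinearMap.comp_apply, frame_smul_self]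

/-! ### The Lie bracket -/

/-- The Lie bracket of the Lie algebra as a continuous bilinear map. -/
def bracket (G : CarnotGroup m) : Coord m →L[ℝ] Coord m →L[ℝ] Coord m :=
  fderiv ℝ G.frame 0 - (fderiv ℝ G.frame 0).flip

theorem fderiv_leftInvField (G : CarnotGroup m) (v x h : Coord m) :
    fderiv ℝ (leftInvField G.mul v) x h = fderiv ℝ G.frame x h v := by
  have := (G.hasFDerivAt_frame x).clm_apply (hasFDerivAt_const v x)
  have h2 : HasFDerivAt (leftInvField G.mul v) _ x := this
  rw [h2.fderiv]
  simp

theorem leftInvBracket_eq (G : CarnotGroup m) (v w : Coord m) :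
    leftInvBracket G.mul v w = G.bracket v w := by
  simp [leftInvBracket, VectorField.lieBracket, fderiv_leftInvField, bracket, leftInvField_eq,
    frame_zero]

theorem contDiff_leftInvField (G : CarnotGroup m) (v : Coord m) :
    ContDiff ℝ ∞ (leftInvField G.mul v) :=
  G.contDiff_frame.clm_apply contDiff_const

theorem minSmoothness_two_le : minSmoothness ℝ 2 ≤ (∞ : WithTop ℕ∞) := by
  rw [minSmoothness_of_isRCLikeNormedField]
  exact ENat.LEInfty.out

theorem lieBracket_leftInvField (G : CarnotGroup m) (v w : Coord m) :
    VectorField.lieBracket ℝ (leftInvField G.mul v) (leftInvField G.mul w) =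
      leftInvField G.mul (G.bracket v w) := by
  have key : ∀ p v, VectorField.pullback ℝ (G.mul p) (leftInvField G.mul v) =
      leftInvField G.mul v := by
    intro p v
    ext1 y
    obtain ⟨e, he⟩ := G.isInvertible_fderiv_mul_left p y
    rw [VectorField.pullback_eq_of_fderiv_eq he, leftInvField_eq, leftInvField_eq, frame_mul,
      ContinuousLinearMap.comp_apply, ← he]
    simp
  have hd : ∀ v x, DifferentiableAt ℝ (leftInvField G.mul v) x := fun v x =>
    (G.contDiff_leftInvField v).differentiable (by simp) x
  ext1 p
  have h1 := VectorField.pullback_lieBracket (𝕜 := ℝ) (n := ∞) minSmoothness_two_le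
    (f := G.mul p) (x := 0) (G.contDiff_mul_left p).contDiffAt (hd v _) (hd w _)
  have h2 := VectorField.fderiv_pullback (𝕜 := ℝ) (G.mul p)
    (VectorField.lieBracket ℝ (leftInvField G.mul v) (leftInvField G.mul w)) 0
    (G.isInvertible_fderiv_mul_left p 0)
  rw [h1, key, key, G.mul_zero] at h2
  rw [← h2, leftInvField_eq, ← leftInvBracket_eq]
  rfl

theorem bracket_leibniz (G : CarnotGroup m) (u v w : Coord m) :
    G.bracket u (G.bracket v w) =
      G.bracket (G.bracket u v) w + G.bracket v (G.bracket u w) := by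
  have hc : ∀ v, ContDiffAt ℝ ∞ (leftInvField G.mul v) 0 := fun v =>
    (G.contDiff_leftInvField v).contDiffAt
  have h := VectorField.leibniz_identity_lieBracket (𝕜 := ℝ) (n := ∞) minSmoothness_two_le
    (hc u) (hc v) (hc w)
  simp only [lieBracket_leftInvField, leftInvField_eq, frame_zero,
    ContinuousLinearMap.id_apply] at h
  exact h

/-- The structure equation of the frame: `[X_v, X_w] = X_{[v, w]}`, written out. -/
theorem frame_bracket (G : CarnotGroup m) (p v w : Coord m) :
    fderiv ℝ G.frame p (G.frame p v) w - fderiv ℝ G.frame p (G.frame p w) v =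
      G.frame p (G.bracket v w) := by
  have h := congrFun (G.lieBracket_leftInvField v w) p
  simpa [VectorField.lieBracket, fderiv_leftInvField, leftInvField_eq] using h

/-! ### Automorphisms of the Lie algebra are automorphisms of the group -/

theorem hasDerivAt_coframe_smul (G : CarnotGroup m) (x w : Coord m) (s : ℝ) :
    HasDerivAt (fun t : ℝ => G.coframe (t • x) (t • w))
      (w - G.bracket x (G.coframe (s • x) (s • w))) s := by
  set q : ℝ → Coord m := fun t => G.coframe (t • x) (t • w) with hq
  have hline : ∀ y : Coord m, HasDerivAt (fun t : ℝ => t • y) y s := fun y => by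
    simpa using (hasDerivAt_id s).smul_const y
  have hqd : HasDerivAt q (deriv q s) s := by
    have hs : ∀ y : Coord m, ContDiff ℝ ∞ (fun t : ℝ => t • y) := fun y =>
      contDiff_id.smul contDiff_const
    have hc : ContDiff ℝ ∞ q := (G.contDiff_coframe.comp (hs x)).clm_apply (hs w)
    exact (hc.differentiable (by simp) s).hasDerivAt
  -- differentiate `M(sx) q(s) = s w`
  have h1 : fderiv ℝ G.frame (s • x) x (q s) + G.frame (s • x) (deriv q s) = w := by
    have hM := (G.hasFDerivAt_frame (s • x)).comp_hasDerivAt s (hline x)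
    have h := hM.clm_apply hqd
    have e : (fun t : ℝ => t • w) =ᶠ[𝓝 s] fun t => (G.frame ∘ fun t : ℝ => t • x) t (q t) :=
      Eventually.of_forall fun t => (G.frame_coframe (t • x) (t • w)).symm
    exact (h.congr_of_eventuallyEq e).unique (hline w)
  -- differentiate `M(p) p = p` at `p = s x` in the direction `w`
  have h2 : s • fderiv ℝ G.frame (s • x) w x + G.frame (s • x) w = w := by
    have h := (G.hasFDerivAt_frame (s • x)).clm_apply (hasFDerivAt_id (s • x))
    have e : (id : Coord m → Coord m) =ᶠ[𝓝 (s • x)] fun p => G.frame p (id p) := by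
      refine Eventually.of_forall fun p => ?_
      have := G.frame_smul_self 1 p
      rw [one_smul] at this
      exact this.symm
    have h3 := congrArg (fun L => L w)
      ((h.congr_of_eventuallyEq e).unique (hasFDerivAt_id (s • x)))
    simpa [add_comm] using h3
  have h3 := G.frame_bracket (s • x) x (q s)
  have h4 : G.frame (s • x) (q s) = s • w := G.frame_coframe _ _
  rw [G.frame_smul_self, h4, map_smul, _root_.smul_apply] at h3
  have h5 : G.frame (s • x) (deriv q s) = G.frame (s • x) (w - G.bracket x (q s)) := by
    rw [map_sub, ← h3]
    have e1 : G.frame (s • x) (deriv q s) = w - fderiv ℝ G.frame (s • x) x (q s) := by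
      rw [← h1]; abel
    have e2 : G.frame (s • x) w = w - s • fderiv ℝ G.frame (s • x) w x := by
      nth_rewrite 2 [← h2]; abel
    rw [e1, e2]; abel
  have h6 : deriv q s = w - G.bracket x (q s) := by
    have := congrArg (G.coframe (s • x)) h5
    rwa [coframe_frame, coframe_frame] at this
  rw [← h6]
  exact hqd

/-- An automorphism of the Lie algebra maps the frame to the frame. Both sides of
`L N(x) = N(L x) L`, where `N` is `coframe`, are the value at time `1` of a solution of the same
linear differential equation along the ray through `x`. -/
theorem map_frame (G : CarnotGroup m) (L : Coord m →L[ℝ] Coord m)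
    (hL : ∀ v w, L (G.bracket v w) = G.bracket (L v) (L w)) (x v : Coord m) :
    L (G.frame x v) = G.frame (L x) (L v) := by
  have hN : ∀ w, L (G.coframe x w) = G.coframe (L x) (L w) := by
    intro w
    have hlip : ∀ t : ℝ, LipschitzOnWith ‖G.bracket (L x)‖₊
        (fun z => L w - G.bracket (L x) z) univ := by
      intro t
      refine LipschitzWith.lipschitzOnWith (LipschitzWith.of_dist_le_mul fun a b => ?_)
      rw [dist_sub_left]
      exact (G.bracket (L x)).lipschitz.dist_le_mul a b
    have hf : ∀ t : ℝ, HasDerivAt (fun t : ℝ => L (G.coframe (t • x) (t • w)))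
        (L w - G.bracket (L x) (L (G.coframe (t • x) (t • w)))) t := by
      intro t
      have := L.hasFDerivAt.comp_hasDerivAt t (G.hasDerivAt_coframe_smul x w t)
      rw [map_sub, hL] at this
      exact this
    have hg := G.hasDerivAt_coframe_smul (L x) (L w)
    have h := ODE_solution_unique_univ (v := fun _ z => L w - G.bracket (L x) z)
      (s := fun _ => univ) (t₀ := 0) hlip (fun t => ⟨hf t, mem_univ _⟩)
      (fun t => ⟨hg t, mem_univ _⟩) (by simp)
    simpa using congrFun h 1
  have h := congrArg (G.frame (L x)) (hN (G.frame x v))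
  rw [coframe_frame, frame_coframe] at h
  exact h.symm

/-- Uniqueness of integral curves of left-invariant fields: an integral curve `c` of `X_w` is a
left translate of the line `s ↦ s w`, because `c(s) (s w)⁻¹` is constant. -/
theorem eq_mul_smul_of_hasDerivAt (G : CarnotGroup m) (w : Coord m) (c : ℝ → Coord m)
    (hc : ∀ s, HasDerivAt c (G.frame (c s) w) s) (s : ℝ) : c s = G.mul (c 0) (s • w) := by
  have hmul : ∀ q : Coord m × Coord m, HasFDerivAt (fun q : Coord m × Coord m => G.mul q.1 q.2)
      (fderiv ℝ (fun q : Coord m × Coord m => G.mul q.1 q.2) q) q := fun q =>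
    (G.contDiff_mul.differentiable (by simp) q).hasFDerivAt
  have hneg : ∀ s : ℝ, HasDerivAt (fun t : ℝ => (-t) • w) (-w) s := fun s => by
    simpa using (hasDerivAt_neg s).smul_const w
  have hder : ∀ s, HasDerivAt (fun t : ℝ => G.mul (c t) ((-t) • w)) 0 s := by
    intro s
    set D := fderiv ℝ (fun q : Coord m × Coord m => G.mul q.1 q.2) (c s, (-s) • w) with hD
    have h1 := (hmul (c s, (-s) • w)).comp_hasDerivAt s ((hc s).prodMk (hneg s))
    -- the curve `ε ↦ (c(s) (ε w)) (-s w) = c(s) ((ε - s) w)` gives the first partial derivative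
    have h2 : D (G.frame (c s) w, 0) = G.frame (G.mul (c s) ((-s) • w)) w := by
      have ha : HasDerivAt (fun t : ℝ => G.mul (c s) (t • w)) (G.frame (c s) w) 0 := by
        have := G.hasDerivAt_mul_smul (c s) w 0
        rwa [zero_smul] at this
      have hb : HasFDerivAt (fun q : Coord m × Coord m => G.mul q.1 q.2) D
          (G.mul (c s) ((0 : ℝ) • w), (-s) • w) := by
        rw [zero_smul, G.mul_zero]
        exact hmul _
      have h := hb.comp_hasDerivAt (0 : ℝ) (ha.prodMk (hasDerivAt_const (0 : ℝ) ((-s) • w)))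
      have h' : HasDerivAt (fun t : ℝ => G.mul (c s) ((-s + t) • w))
          (D (G.frame (c s) w, 0)) 0 := by
        refine h.congr_of_eventuallyEq (Eventually.of_forall fun t => ?_)
        simp only [Function.comp_apply]
        rw [G.mul_assoc, G.smul_mul_smul, add_comm]
      have h3 : HasDerivAt (fun t : ℝ => G.mul (c s) ((-s + t) • w))
          (fderiv ℝ (G.mul (c s)) ((-s) • w) w) 0 := by
        have e : HasDerivAt (fun t : ℝ => G.mul (c s) (t • w))
          (fderiv ℝ (G.mul (c s)) ((-s) • w) w) (-s + 0) := by
          rw [add_zero]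
          exact G.hasDerivAt_mul_smul _ _ _
        exact e.comp_const_add (-s) 0
      rw [h'.unique h3, fderiv_mul_left_smul_self]
    have h4 : D (0, w) = G.frame (G.mul (c s) ((-s) • w)) w := by
      have h := (hmul (c s, (-s) • w)).comp ((-s) • w)
        ((hasFDerivAt_const (c s) ((-s) • w)).prodMk (hasFDerivAt_id ((-s) • w)))
      have h' := congrArg (fun L => L w) (h.unique (G.hasFDerivAt_mul_left (c s) ((-s) • w)))
      rw [← fderiv_mul_left_smul_self, ← h']
      simp [hD]
    have h5 : D (G.frame (c s) w, -w) = 0 := by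
      have : ((G.frame (c s) w, -w) : Coord m × Coord m) =
          (G.frame (c s) w, 0) - (0, w) := by simp
      rw [this, map_sub, h2, h4, sub_self]
    rw [← h5]
    exact h1
  have hconst := is_const_of_deriv_eq_zero (fun s => (hder s).differentiableAt)
    (fun s => (hder s).deriv) s 0
  simp only [neg_zero, zero_smul, G.mul_zero] at hconst
  rw [← hconst, neg_smul, G.neg_mul_cancel_right]

theorem map_mul_of_map_bracket (G : CarnotGroup m) (L : Coord m →L[ℝ] Coord m)
    (hL : ∀ v w, L (G.bracket v w) = G.bracket (L v) (L w)) (x y : Coord m) :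
    L (G.mul x y) = G.mul (L x) (L y) := by
  have h := G.eq_mul_smul_of_hasDerivAt (L y) (fun s => L (G.mul x (s • y))) (fun s => by
    have := L.hasFDerivAt.comp_hasDerivAt s (G.hasDerivAt_mul_smul x y s)
    rw [fderiv_mul_left_smul_self, G.map_frame L hL] at this
    exact this) 1
  simpa [G.mul_zero] using h

/-! ### Dilations -/

/-- The dilation by `c`: multiplication by `c ^ k` on the layer `V^k`. -/
def dilation (m : Fin r → ℕ) (c : ℝ) : Coord m →L[ℝ] Coord m :=
  ContinuousLinearMap.pi fun k => c ^ ((k : ℕ) + 1) • ContinuousLinearMap.proj k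

theorem dilation_apply (c : ℝ) (x : Coord m) (k : Fin r) (i : Fin (m k)) :
    dilation m c x k i = c ^ ((k : ℕ) + 1) * x k i := rfl

theorem dilation_dilation (c d : ℝ) (x : Coord m) :
    dilation m c (dilation m d x) = dilation m (c * d) x := by
  ext k i
  simp only [dilation_apply]
  ring

theorem dilation_one (x : Coord m) : dilation m 1 x = x := by
  ext k i
  simp [dilation_apply]

theorem dilation_inv_dilation {c : ℝ} (hc : c ≠ 0) (x : Coord m) :
    dilation m c⁻¹ (dilation m c x) = x := by
  rw [dilation_dilation, inv_mul_cancel₀ hc, dilation_one]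

theorem dilation_dilation_inv {c : ℝ} (hc : c ≠ 0) (x : Coord m) :
    dilation m c (dilation m c⁻¹ x) = x := by
  rw [dilation_dilation, mul_inv_cancel₀ hc, dilation_one]

theorem dilation_of_mem_layer {k : ℕ} {v : Coord m} (hv : v ∈ layer m k) (c : ℝ) :
    dilation m c v = c ^ k • v := by
  ext j i
  simp only [dilation_apply, Pi.smul_apply, smul_eq_mul]
  by_cases h : (j : ℕ) + 1 = k
  · rw [h]
  · have : v j = 0 := hv j h
    simp [this]

theorem single_mem_layer (k : Fin r) (v : Fin (m k) → ℝ) :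
    (Pi.single k v : Coord m) ∈ layer m ((k : ℕ) + 1) := by
  intro j hj
  have : j ≠ k := by
    rintro rfl
    exact hj rfl
  exact Pi.single_eq_of_ne (M := fun k => Fin (m k) → ℝ) this v

theorem bracket_mem_layer_one (G : CarnotGroup m) {k : ℕ} (hk : 1 ≤ k) {v w : Coord m}
    (hv : v ∈ layer m 1) (hw : w ∈ layer m k) : G.bracket v w ∈ layer m (k + 1) := by
  rw [← G.span_bracket k hk]
  exact Submodule.subset_span ⟨v, hv, w, hw, G.leftInvBracket_eq v w⟩

/-- `[V^i, V^j] ⊆ V^{i+j}`, by induction on `i` with the Jacobi identity. -/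
theorem bracket_mem_layer (G : CarnotGroup m) {i : ℕ} (hi : 1 ≤ i) :
    ∀ {j : ℕ}, 1 ≤ j → ∀ {v w : Coord m}, v ∈ layer m i → w ∈ layer m j →
      G.bracket v w ∈ layer m (i + j) := by
  induction i, hi using Nat.le_induction with
  | base =>
    intro j hj v w hv hw
    rw [add_comm]
    exact G.bracket_mem_layer_one hj hv hw
  | succ i hi ih =>
    intro j hj v w hv hw
    rw [← G.span_bracket i hi] at hv
    induction hv using Submodule.span_induction with
    | mem z hz =>
      obtain ⟨a, ha, b, hb, rfl⟩ := hz
      rw [leftInvBracket_eq]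
      have h : G.bracket (G.bracket a b) w =
          G.bracket a (G.bracket b w) - G.bracket b (G.bracket a w) := by
        rw [G.bracket_leibniz a b w, add_sub_cancel_right]
      rw [h]
      refine Submodule.sub_mem _ ?_ ?_
      · have := G.bracket_mem_layer_one (by omega) ha (ih hj hb hw)
        rwa [show i + 1 + j = i + j + 1 by ring]
      · have := ih (by omega) hb (G.bracket_mem_layer_one hj ha hw)
        rwa [show i + 1 + j = i + (j + 1) by ring]
    | zero => simp
    | add x y _ _ hx hy =>
      rw [map_add]
      exact Submodule.add_mem _ hx hy
    | smul c x _ hx =>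
      rw [map_smul]
      exact Submodule.smul_mem _ c hx

theorem dilation_bracket (G : CarnotGroup m) (c : ℝ) (v w : Coord m) :
    dilation m c (G.bracket v w) = G.bracket (dilation m c v) (dilation m c w) := by
  have hdec : ∀ v : Coord m, v = ∑ k, Pi.single k (v k) := fun v =>
    (Finset.univ_sum_single v).symm
  rw [hdec v, hdec w]
  simp only [map_sum, _root_.sum_apply]
  refine Finset.sum_congr rfl fun k _ => Finset.sum_congr rfl fun l _ => ?_
  have hk := single_mem_layer (m := m) k (w k)
  have hl := single_mem_layer (m := m) l (v l)
  rw [dilation_of_mem_layer hk, dilation_of_mem_layer hl,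
    dilation_of_mem_layer (G.bracket_mem_layer (by omega) (by omega) hl hk)]
  simp only [map_smul, _root_.smul_apply, smul_smul]
  rw [pow_add, mul_comm]

theorem dilation_mul (G : CarnotGroup m) (c : ℝ) (x y : Coord m) :
    dilation m c (G.mul x y) = G.mul (dilation m c x) (dilation m c y) :=
  G.map_mul_of_map_bracket _ (G.dilation_bracket c) x y

/-! ### Invariance of Lebesgue measure -/

theorem det_dilation_ne_zero {c : ℝ} (hc : c ≠ 0) : (dilation m c).det ≠ 0 := by
  have h : (dilation m c⁻¹).comp (dilation m c) = ContinuousLinearMap.id ℝ (Coord m) := by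
    ext1 x
    exact dilation_inv_dilation hc x
  have h2 := congrArg ContinuousLinearMap.det h
  intro h0
  simp only [ContinuousLinearMap.det, ContinuousLinearMap.toLinearMap_comp, LinearMap.det_comp,
    ContinuousLinearMap.coe_id, LinearMap.det_id] at h2 h0
  rw [h0, MulZeroClass.mul_zero] at h2
  exact zero_ne_one h2

theorem det_comp (L M : Coord m →L[ℝ] Coord m) : (L.comp M).det = L.det * M.det :=
  LinearMap.det_comp _ _

/-- The determinant of the frame is constant on the orbits of the dilations, all of which
accumulate at `0`. -/
theorem det_frame (G : CarnotGroup m) (x : Coord m) : (G.frame x).det = 1 := by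
  have h1 : ∀ c : ℝ, c ≠ 0 → (G.frame (dilation m c x)).det = (G.frame x).det := by
    intro c hc
    have h : (dilation m c).comp (G.frame x) = (G.frame (dilation m c x)).comp (dilation m c) := by
      ext1 v
      exact G.map_frame _ (G.dilation_bracket c) x v
    have h2 := congrArg ContinuousLinearMap.det h
    rw [det_comp, det_comp, mul_comm] at h2
    exact (mul_right_cancel₀ (det_dilation_ne_zero hc) h2).symm
  have hd : Continuous fun c : ℝ => dilation m c x := by
    refine continuous_pi fun k => continuous_pi fun i => ?_
    simp only [dilation_apply]
    fun_prop
  have hcont : Continuous fun c : ℝ => (G.frame (dilation m c x)).det :=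
    ContinuousLinearMap.continuous_det.comp (G.contDiff_frame.continuous.comp hd)
  have h0 : dilation m 0 x = 0 := by
    ext k i
    simp [dilation_apply]
  have hlim : Tendsto (fun c : ℝ => (G.frame (dilation m c x)).det) (𝓝[≠] 0) (𝓝 1) := by
    have := (hcont.tendsto 0).mono_left (nhdsWithin_le_nhds (s := {0}ᶜ))
    rw [h0, G.frame_zero] at this
    simpa [ContinuousLinearMap.det] using this
  have hlim' : Tendsto (fun c : ℝ => (G.frame (dilation m c x)).det) (𝓝[≠] 0)
      (𝓝 (G.frame x).det) := by
    refine tendsto_const_nhds.congr' ?_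
    filter_upwards [self_mem_nhdsWithin] with c hc
    exact (h1 c hc).symm
  exact tendsto_nhds_unique hlim' hlim

theorem det_fderiv_mul_left (G : CarnotGroup m) (x y : Coord m) :
    (fderiv ℝ (G.mul x) y).det = 1 := by
  have h := congrArg ContinuousLinearMap.det (G.frame_mul x y)
  rw [det_comp, det_frame, det_frame, mul_one] at h
  exact h.symm

theorem volume_image_mul_left (G : CarnotGroup m) (x : Coord m) {s : Set (Coord m)}
    (hs : MeasurableSet s) : volume (G.mul x '' s) = volume s := by
  rw [← lintegral_abs_det_fderiv_eq_addHaar_image volume hs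
    (fun y _ => (G.hasFDerivAt_mul_left x y).hasFDerivWithinAt)
    (fun y _ z _ h => by
      rw [← G.neg_mul_cancel_left x y, ← G.neg_mul_cancel_left x z]
      exact congrArg _ h)]
  simp [det_fderiv_mul_left]

theorem volume_neg (s : Set (Coord m)) : volume (-s) = volume s := by
  have : (volume : Measure (Coord m)).IsNegInvariant :=
    Measure.IsAddHaarMeasure.isNegInvariant_of_regular _
  exact Measure.measure_neg volume s

/-- Right translations are left translations conjugated by the inversion `x ↦ -x`, which preserves
Lebesgue measure. -/
theorem volume_image_mul_right (G : CarnotGroup m) (x : Coord m) {s : Set (Coord m)}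
    (hs : MeasurableSet s) : volume ((fun y => G.mul y x) '' s) = volume s := by
  have h : (fun y => G.mul y x) '' s = -(G.mul (-x) '' (-s)) := by
    ext z
    constructor
    · rintro ⟨y, hy, rfl⟩
      refine ⟨-y, by simpa using hy, ?_⟩
      rw [neg_mul_rev]
    · rintro ⟨y, hy, hz⟩
      refine ⟨-y, hy, ?_⟩
      simp only
      rw [← neg_neg z, ← hz, neg_mul_rev, neg_neg]
  rw [h, volume_neg, G.volume_image_mul_left _ hs.neg, volume_neg]

/-! ### The gauge norm -/

theorem gauge_exponent_pos (k : Fin r) : 0 < (2 * (r ! : ℝ)) / ((k : ℝ) + 1) := by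
  have := Nat.factorial_pos r
  positivity

theorem gauge_sum_nonneg (x : Coord m) :
    0 ≤ ∑ k : Fin r, ∑ i : Fin (m k), |x k i| ^ ((2 * (r ! : ℝ)) / ((k : ℝ) + 1)) :=
  Finset.sum_nonneg fun _ _ => Finset.sum_nonneg fun _ _ => Real.rpow_nonneg (abs_nonneg _) _

theorem gauge_nonneg (x : Coord m) : 0 ≤ gauge x := Real.rpow_nonneg (gauge_sum_nonneg x) _

theorem gauge_neg (x : Coord m) : gauge (-x) = gauge x := by
  simp [gauge]

theorem gauge_zero : gauge (0 : Coord m) = 0 := by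
  have h1 : ∀ k : Fin r, (0 : ℝ) ^ ((2 * (r ! : ℝ)) / ((k : ℝ) + 1)) = 0 := fun k =>
    Real.zero_rpow (gauge_exponent_pos k).ne'
  have h2 : 1 / (2 * (r ! : ℝ)) ≠ 0 := by
    have := Nat.factorial_pos r
    positivity
  simp only [gauge, Pi.zero_apply, abs_zero, h1, Finset.sum_const_zero]
  exact Real.zero_rpow h2

theorem continuous_gauge : Continuous (gauge : Coord m → ℝ) := by
  have h : Continuous fun x : Coord m =>
      ∑ k : Fin r, ∑ i : Fin (m k), |x k i| ^ ((2 * (r ! : ℝ)) / ((k : ℝ) + 1)) := by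
    refine continuous_finsetSum _ fun k _ => continuous_finsetSum _ fun i _ => ?_
    exact Continuous.rpow_const (by fun_prop) fun x => Or.inr (gauge_exponent_pos k).le
  exact h.rpow_const fun x => Or.inr (by positivity)

theorem gauge_dilation {c : ℝ} (hc : 0 ≤ c) (x : Coord m) :
    gauge (dilation m c x) = c * gauge x := by
  have hr : (0 : ℝ) < 2 * (r ! : ℝ) := by
    have := Nat.factorial_pos r
    positivity
  have h : ∀ (k : Fin r) (i : Fin (m k)),
      |dilation m c x k i| ^ ((2 * (r ! : ℝ)) / ((k : ℝ) + 1)) =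
        c ^ (2 * (r ! : ℝ)) * |x k i| ^ ((2 * (r ! : ℝ)) / ((k : ℝ) + 1)) := by
    intro k i
    rw [dilation_apply, abs_mul, abs_of_nonneg (pow_nonneg hc _),
      Real.mul_rpow (pow_nonneg hc _) (abs_nonneg _), ← Real.rpow_natCast, ← Real.rpow_mul hc]
    congr 2
    push_cast
    field_simp
  simp only [gauge, h, ← Finset.mul_sum]
  rw [Real.mul_rpow (Real.rpow_nonneg hc _) (gauge_sum_nonneg x), ← Real.rpow_mul hc,
    mul_one_div_cancel hr.ne', Real.rpow_one]

theorem abs_rpow_le_gauge_rpow (x : Coord m) (k : Fin r) (i : Fin (m k)) :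
    |x k i| ^ ((2 * (r ! : ℝ)) / ((k : ℝ) + 1)) ≤ gauge x ^ (2 * (r ! : ℝ)) := by
  have hr : (0 : ℝ) < 2 * (r ! : ℝ) := by
    have := Nat.factorial_pos r
    positivity
  rw [gauge, ← Real.rpow_mul (gauge_sum_nonneg x), one_div_mul_cancel hr.ne', Real.rpow_one]
  refine (Finset.single_le_sum (f := fun i => |x k i| ^ ((2 * (r ! : ℝ)) / ((k : ℝ) + 1)))
    (fun _ _ => Real.rpow_nonneg (abs_nonneg _) _) (Finset.mem_univ i)).trans ?_
  exact Finset.single_le_sum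
    (f := fun k => ∑ i, |x k i| ^ ((2 * (r ! : ℝ)) / ((k : ℝ) + 1)))
    (fun _ _ => Finset.sum_nonneg fun _ _ => Real.rpow_nonneg (abs_nonneg _) _)
    (Finset.mem_univ k)

theorem norm_le_one_of_gauge_le_one {x : Coord m} (hx : gauge x ≤ 1) : ‖x‖ ≤ 1 := by
  refine (pi_norm_le_iff_of_nonneg zero_le_one).2 fun k =>
    (pi_norm_le_iff_of_nonneg zero_le_one).2 fun i => ?_
  rw [Real.norm_eq_abs]
  by_contra! h
  have h1 := Real.one_lt_rpow h (gauge_exponent_pos k)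
  have h2 : gauge x ^ (2 * (r ! : ℝ)) ≤ 1 :=
    Real.rpow_le_one (gauge_nonneg x) hx (by positivity)
  linarith [abs_rpow_le_gauge_rpow x k i]

theorem eq_zero_of_gauge_eq_zero {x : Coord m} (hx : gauge x = 0) : x = 0 := by
  have hr : (2 * (r ! : ℝ)) ≠ 0 := by
    have := Nat.factorial_pos r
    positivity
  ext k i
  have h := abs_rpow_le_gauge_rpow x k i
  rw [hx, Real.zero_rpow hr] at h
  have h2 := le_antisymm h (Real.rpow_nonneg (abs_nonneg _) _)
  rw [Real.rpow_eq_zero (abs_nonneg _) (gauge_exponent_pos k).ne'] at h2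
  simpa using h2

/-- The gauge is a quasi-norm: by homogeneity the bound follows from its continuity and the
compactness of the unit ball. -/
theorem exists_gauge_mul_le (G : CarnotGroup m) :
    ∃ K : ℝ, 1 ≤ K ∧ ∀ x y, gauge (G.mul x y) ≤ K * (gauge x + gauge y) := by
  have hcomp : IsCompact (Metric.closedBall (0 : Coord m) 1 ×ˢ Metric.closedBall (0 : Coord m) 1) :=
    (isCompact_closedBall _ _).prod (isCompact_closedBall _ _)
  have hcont : Continuous fun q : Coord m × Coord m => gauge (G.mul q.1 q.2) :=
    continuous_gauge.comp G.contDiff_mul.continuous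
  obtain ⟨K, hK⟩ := hcomp.bddAbove_image hcont.continuousOn
  refine ⟨max K 1, le_max_right _ _, fun x y => ?_⟩
  rcases (add_nonneg (gauge_nonneg x) (gauge_nonneg y)).eq_or_lt with h0 | hpos
  · have hx : gauge x = 0 := by linarith [gauge_nonneg x, gauge_nonneg y]
    have hy : gauge y = 0 := by linarith [gauge_nonneg x, gauge_nonneg y]
    rw [eq_zero_of_gauge_eq_zero hx, eq_zero_of_gauge_eq_zero hy, G.mul_zero]
    simp [gauge_zero]
  · set c := gauge x + gauge y with hc
    have hunit : ∀ z : Coord m, gauge z ≤ c →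
        dilation m c⁻¹ z ∈ Metric.closedBall (0 : Coord m) 1 := by
      intro z hz
      rw [mem_closedBall_zero_iff]
      apply norm_le_one_of_gauge_le_one
      rw [gauge_dilation (inv_nonneg.2 hpos.le), inv_mul_le_iff₀ hpos, mul_one]
      exact hz
    have h1 : gauge (G.mul (dilation m c⁻¹ x) (dilation m c⁻¹ y)) ≤ K :=
      hK ⟨(dilation m c⁻¹ x, dilation m c⁻¹ y),
        ⟨hunit x (by linarith [gauge_nonneg y]), hunit y (by linarith [gauge_nonneg x])⟩, rfl⟩
    rw [← dilation_mul, gauge_dilation (inv_nonneg.2 hpos.le), inv_mul_le_iff₀ hpos] at h1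
    calc gauge (G.mul x y) ≤ c * K := h1
      _ = K * c := mul_comm _ _
      _ ≤ max K 1 * c := by gcongr; exact le_max_left _ _

theorem volume_gauge_ball_mul {c : ℝ} (hc : 0 < c) (ρ : ℝ) :
    volume {x : Coord m | gauge x < c * ρ} =
      ENNReal.ofReal |(dilation m c).det| * volume {x : Coord m | gauge x < ρ} := by
  have h : {x : Coord m | gauge x < c * ρ} = dilation m c '' {x | gauge x < ρ} := by
    ext x
    constructor
    · intro hx
      refine ⟨dilation m c⁻¹ x, ?_, dilation_dilation_inv hc.ne' x⟩
      rw [mem_ofPred_eq, gauge_dilation (inv_nonneg.2 hc.le), inv_mul_lt_iff₀ hc]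
      exact hx
    · rintro ⟨y, hy, rfl⟩
      rw [mem_ofPred_eq, gauge_dilation hc.le]
      exact mul_lt_mul_of_pos_left hy hc
  rw [h]
  exact Measure.addHaar_image_continuousLinearMap volume (dilation m c) _

theorem isOpen_gauge_ball (ρ : ℝ) : IsOpen {x : Coord m | gauge x < ρ} :=
  isOpen_lt continuous_gauge continuous_const

theorem norm_le_of_gauge_le {x : Coord m} {ρ : ℝ} (hρ₀ : 0 < ρ) (hρ₁ : ρ ≤ 1)
    (hx : gauge x ≤ ρ) : ‖x‖ ≤ ρ := by
  have h1 : ‖dilation m ρ⁻¹ x‖ ≤ 1 := by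
    apply norm_le_one_of_gauge_le_one
    rwa [gauge_dilation (inv_nonneg.2 hρ₀.le), inv_mul_le_iff₀ hρ₀, mul_one]
  refine (pi_norm_le_iff_of_nonneg hρ₀.le).2 fun k =>
    (pi_norm_le_iff_of_nonneg hρ₀.le).2 fun i => ?_
  have h2 : |dilation m ρ⁻¹ x k i| ≤ 1 :=
    ((norm_le_pi_norm (dilation m ρ⁻¹ x k) i).trans (norm_le_pi_norm _ k)).trans h1
  rw [← dilation_dilation_inv hρ₀.ne' x, dilation_apply, Real.norm_eq_abs, abs_mul,
    abs_of_nonneg (pow_nonneg hρ₀.le _)]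
  calc ρ ^ ((k : ℕ) + 1) * |dilation m ρ⁻¹ x k i| ≤ ρ ^ ((k : ℕ) + 1) * 1 := by gcongr
    _ = ρ ^ (k : ℕ) * ρ := by rw [mul_one, pow_succ]
    _ ≤ 1 * ρ := by gcongr; exact pow_le_one₀ hρ₀.le hρ₁
    _ = ρ := one_mul ρ

theorem isCompact_gauge_closedBall {ρ : ℝ} (hρ : 0 < ρ) :
    IsCompact {x : Coord m | gauge x ≤ ρ} := by
  refine ((isCompact_closedBall (0 : Coord m) 1).image (dilation m ρ).continuous).of_isClosed_subset
    (isClosed_le continuous_gauge continuous_const) fun x hx => ?_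
  refine ⟨dilation m ρ⁻¹ x, ?_, dilation_dilation_inv hρ.ne' x⟩
  rw [mem_closedBall_zero_iff]
  apply norm_le_one_of_gauge_le_one
  rw [gauge_dilation (inv_nonneg.2 hρ.le), inv_mul_le_iff₀ hρ, mul_one]
  exact hx

theorem volume_gauge_ball_lt_top {ρ : ℝ} (hρ : 0 < ρ) :
    volume {x : Coord m | gauge x < ρ} < ⊤ := by
  have h : {x : Coord m | gauge x < ρ} ⊆ {x | gauge x ≤ ρ} := fun x hx =>
    le_of_lt (show gauge x < ρ from hx)
  exact (measure_mono h).trans_lt (isCompact_gauge_closedBall hρ).measure_lt_top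

theorem volume_gauge_ball_pos {ρ : ℝ} (hρ : 0 < ρ) : 0 < volume {x : Coord m | gauge x < ρ} :=
  (isOpen_gauge_ball ρ).measure_pos volume ⟨0, by rwa [mem_ofPred_eq, gauge_zero]⟩

/-! ### Parabolic cylinders -/

theorem dist_nonneg (G : CarnotGroup m) (x y : Coord m) : 0 ≤ G.dist x y := gauge_nonneg _

theorem dist_comm (G : CarnotGroup m) (x y : Coord m) : G.dist x y = G.dist y x := by
  rw [dist, ← gauge_neg, neg_mul_rev, neg_neg, dist]

theorem dist_self (G : CarnotGroup m) (x : Coord m) : G.dist x x = 0 := by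
  rw [dist, G.mul_neg_self, gauge_zero]

theorem eq_of_dist_eq_zero (G : CarnotGroup m) {x y : Coord m} (h : G.dist x y = 0) : x = y := by
  rw [← G.neg_mul_cancel_right x y, eq_zero_of_gauge_eq_zero h, G.zero_mul]

theorem continuous_dist (G : CarnotGroup m) :
    Continuous fun q : Coord m × Coord m => G.dist q.1 q.2 :=
  continuous_gauge.comp
    (G.contDiff_mul.continuous.comp (continuous_fst.prodMk continuous_snd.neg))

theorem pdist_nonneg (G : CarnotGroup m) (a b : Coord m × ℝ) : 0 ≤ G.pdist a b :=
  Real.sqrt_nonneg _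

theorem pdist_self (G : CarnotGroup m) (a : Coord m × ℝ) : G.pdist a a = 0 := by
  simp [pdist, dist_self]

theorem pdist_sq (G : CarnotGroup m) (a b : Coord m × ℝ) :
    G.pdist a b ^ 2 = G.dist a.1 b.1 ^ 2 + |a.2 - b.2| :=
  Real.sq_sqrt (by positivity)

theorem eq_of_pdist_eq_zero (G : CarnotGroup m) {a b : Coord m × ℝ} (h : G.pdist a b = 0) :
    a = b := by
  have h1 := G.pdist_sq a b
  rw [h] at h1
  have h2 := abs_nonneg (a.2 - b.2)
  have h3 := sq_nonneg (G.dist a.1 b.1)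
  refine Prod.ext (G.eq_of_dist_eq_zero ?_) ?_
  · exact pow_eq_zero_iff two_ne_zero |>.1 (by linarith)
  · exact sub_eq_zero.1 (abs_eq_zero.1 (by linarith))

theorem continuous_pdist (G : CarnotGroup m) :
    Continuous fun q : (Coord m × ℝ) × (Coord m × ℝ) => G.pdist q.1 q.2 := by
  have h : Continuous fun q : (Coord m × ℝ) × (Coord m × ℝ) => G.dist q.1.1 q.2.1 :=
    G.continuous_dist.comp₂ (continuous_fst.comp continuous_fst)
      (continuous_fst.comp continuous_snd)
  unfold pdist
  fun_prop

/-- The quasi-distance on `𝔾 × ℝ` whose balls are the parabolic cylinders; it is comparable to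
`pdist`. -/
def cdist (G : CarnotGroup m) (a b : Coord m × ℝ) : ℝ := max (G.dist a.1 b.1) √|a.2 - b.2|

theorem cdist_comm (G : CarnotGroup m) (a b : Coord m × ℝ) : G.cdist a b = G.cdist b a := by
  rw [cdist, cdist, G.dist_comm, abs_sub_comm]

theorem continuous_cdist (G : CarnotGroup m) :
    Continuous fun q : (Coord m × ℝ) × (Coord m × ℝ) => G.cdist q.1 q.2 := by
  have h : Continuous fun q : (Coord m × ℝ) × (Coord m × ℝ) => G.dist q.1.1 q.2.1 :=
    G.continuous_dist.comp₂ (continuous_fst.comp continuous_fst)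
      (continuous_fst.comp continuous_snd)
  unfold cdist
  fun_prop

theorem mem_cylinder (G : CarnotGroup m) {ρ : ℝ} (hρ : 0 < ρ) (a b : Coord m × ℝ) :
    b ∈ G.cylinder ρ a ↔ G.cdist a b < ρ := by
  rw [cdist, max_lt_iff, Real.sqrt_lt' hρ, and_comm]
  rfl

theorem isOpen_cylinder (G : CarnotGroup m) {ρ : ℝ} (hρ : 0 < ρ) (a : Coord m × ℝ) :
    IsOpen (G.cylinder ρ a) := by
  have : G.cylinder ρ a = {b | G.cdist a b < ρ} := by
    ext b
    exact G.mem_cylinder hρ a b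
  rw [this]
  exact isOpen_lt (G.continuous_cdist.comp₂ continuous_const continuous_id) continuous_const

theorem cylinder_mono (G : CarnotGroup m) {ρ σ : ℝ} (hρ : 0 < ρ) (h : ρ ≤ σ) (a : Coord m × ℝ) :
    G.cylinder ρ a ⊆ G.cylinder σ a := fun b hb =>
  (G.mem_cylinder (hρ.trans_le h) a b).2 (((G.mem_cylinder hρ a b).1 hb).trans_le h)

theorem cdist_le_pdist (G : CarnotGroup m) (a b : Coord m × ℝ) : G.cdist a b ≤ G.pdist a b := by
  rw [cdist, pdist]
  refine max_le (Real.le_sqrt_of_sq_le ?_) (Real.sqrt_le_sqrt ?_)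
  · exact le_add_of_nonneg_right (abs_nonneg _)
  · exact le_add_of_nonneg_left (sq_nonneg _)

theorem pdist_le_two_mul_cdist (G : CarnotGroup m) (a b : Coord m × ℝ) :
    G.pdist a b ≤ 2 * G.cdist a b := by
  have h0 : 0 ≤ G.cdist a b := (G.dist_nonneg _ _).trans (le_max_left _ _)
  refine Real.sqrt_le_iff.2 ⟨by positivity, ?_⟩
  have h1 : G.dist a.1 b.1 ^ 2 ≤ G.cdist a b ^ 2 :=
    pow_le_pow_left₀ (G.dist_nonneg _ _) (le_max_left _ _) 2
  have h2 : |a.2 - b.2| ≤ G.cdist a b ^ 2 := by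
    rw [← Real.sq_sqrt (abs_nonneg (a.2 - b.2))]
    exact pow_le_pow_left₀ (Real.sqrt_nonneg _) (le_max_right _ _) 2
  nlinarith [sq_nonneg (G.cdist a b)]

theorem exists_cdist_triangle (G : CarnotGroup m) :
    ∃ K : ℝ, 1 ≤ K ∧ ∀ a b c, G.cdist a c ≤ K * (G.cdist a b + G.cdist b c) := by
  obtain ⟨K, hK1, hK⟩ := G.exists_gauge_mul_le
  refine ⟨K, hK1, fun a b c => max_le ?_ ?_⟩
  · have h : G.mul a.1 (-c.1) = G.mul (G.mul a.1 (-b.1)) (G.mul b.1 (-c.1)) := by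
      rw [← G.mul_assoc, neg_mul_cancel_right]
    rw [dist, h]
    refine (hK _ _).trans ?_
    gcongr
    · exact le_max_left _ _
    · exact le_max_left _ _
  · have h1 : √|a.2 - c.2| ≤ √|a.2 - b.2| + √|b.2 - c.2| :=
      Real.sqrt_le_iff.2 ⟨by positivity, by
        nlinarith [abs_sub_le a.2 b.2 c.2, Real.sq_sqrt (abs_nonneg (a.2 - b.2)),
          Real.sq_sqrt (abs_nonneg (b.2 - c.2)),
          mul_nonneg (Real.sqrt_nonneg |a.2 - b.2|) (Real.sqrt_nonneg |b.2 - c.2|)]⟩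
    have h2 : √|a.2 - b.2| ≤ G.cdist a b := le_max_right _ _
    have h3 : √|b.2 - c.2| ≤ G.cdist b c := le_max_right _ _
    have h4 := Real.sqrt_nonneg |a.2 - b.2|
    have h5 := Real.sqrt_nonneg |b.2 - c.2|
    nlinarith

/-- A constant `K ≥ 1` in the quasi-triangle inequality for `cdist`. -/
def quasiConst (G : CarnotGroup m) : ℝ := G.exists_cdist_triangle.choose

theorem one_le_quasiConst (G : CarnotGroup m) : 1 ≤ G.quasiConst :=
  G.exists_cdist_triangle.choose_spec.1

theorem cdist_triangle (G : CarnotGroup m) (a b c : Coord m × ℝ) :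
    G.cdist a c ≤ G.quasiConst * (G.cdist a b + G.cdist b c) :=
  G.exists_cdist_triangle.choose_spec.2 a b c

theorem cylinder_eq_prod (G : CarnotGroup m) (ρ : ℝ) (a : Coord m × ℝ) :
    G.cylinder ρ a =
      ((fun y => G.mul y a.1) '' {x | gauge x < ρ}) ×ˢ Metric.ball a.2 (ρ ^ 2) := by
  ext b
  simp only [cylinder, mem_ofPred_eq, mem_prod, Metric.mem_ball, Real.dist_eq, mem_image]
  rw [abs_sub_comm, and_comm, G.dist_comm]
  refine and_congr_left fun _ => ⟨fun h => ⟨_, h, G.neg_mul_cancel_right _ _⟩, ?_⟩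
  rintro ⟨y, hy, h⟩
  rwa [← h, dist, mul_neg_cancel_right]

theorem volume_cylinder (G : CarnotGroup m) (ρ : ℝ) (a : Coord m × ℝ) :
    volume (G.cylinder ρ a) =
      volume {x : Coord m | gauge x < ρ} * ENNReal.ofReal (2 * ρ ^ 2) := by
  rw [cylinder_eq_prod, Measure.volume_eq_prod, Measure.prod_prod,
    G.volume_image_mul_right _ (isOpen_gauge_ball ρ).measurableSet, Real.volume_ball]

theorem volume_cylinder_pos (G : CarnotGroup m) {ρ : ℝ} (hρ : 0 < ρ) (a : Coord m × ℝ) :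
    0 < volume (G.cylinder ρ a) := by
  rw [volume_cylinder]
  exact ENNReal.mul_pos (volume_gauge_ball_pos hρ).ne' (ENNReal.ofReal_pos.2 (by positivity)).ne'

theorem volume_cylinder_lt_top (G : CarnotGroup m) {ρ : ℝ} (hρ : 0 < ρ) (a : Coord m × ℝ) :
    volume (G.cylinder ρ a) < ⊤ := by
  rw [volume_cylinder]
  exact ENNReal.mul_lt_top (volume_gauge_ball_lt_top hρ) ENNReal.ofReal_lt_top

/-- The factor by which the volume of a parabolic cylinder grows when its radius is multiplied
by `c`. -/
def scaleConst (m : Fin r → ℕ) (c : ℝ) : ℝ := |(dilation m c).det| * c ^ 2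

theorem scaleConst_nonneg (c : ℝ) : 0 ≤ scaleConst m c := by
  unfold scaleConst
  positivity

theorem volume_real_cylinder_mul (G : CarnotGroup m) {c : ℝ} (hc : 0 < c) (ρ : ℝ)
    (a b : Coord m × ℝ) :
    volume.real (G.cylinder (c * ρ) a) = scaleConst m c * volume.real (G.cylinder ρ b) := by
  simp only [Measure.real, volume_cylinder, volume_gauge_ball_mul hc, ENNReal.toReal_mul]
  rw [ENNReal.toReal_ofReal (abs_nonneg _), ENNReal.toReal_ofReal (by positivity),
    ENNReal.toReal_ofReal (by positivity), scaleConst]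
  ring

theorem exists_isCompact_cylinder_subset (G : CarnotGroup m) {ρ : ℝ} (hρ : 0 < ρ)
    (a : Coord m × ℝ) : ∃ K, IsCompact K ∧ G.cylinder ρ a ⊆ K := by
  have hc : Continuous fun y => G.mul y a.1 :=
    G.contDiff_mul.continuous.comp (continuous_id.prodMk continuous_const)
  refine ⟨_, ((isCompact_gauge_closedBall hρ).image hc).prod
    (isCompact_closedBall a.2 (ρ ^ 2)), ?_⟩
  rw [cylinder_eq_prod]
  exact prod_mono (image_mono fun x hx => le_of_lt (show gauge x < ρ from hx))
    Metric.ball_subset_closedBall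

/-- Small cylinders about a point are small in the usual topology. -/
theorem exists_cylinder_subset (G : CarnotGroup m) {U : Set (Coord m × ℝ)} (hU : IsOpen U)
    {b : Coord m × ℝ} (hb : b ∈ U) :
    ∃ δ > 0, ∀ ρ, 0 < ρ → ρ < δ → G.cylinder ρ b ⊆ U := by
  set Φ : Coord m × ℝ → Coord m × ℝ := fun w => (G.mul w.1 b.1, w.2) with hΦ
  have hc : Continuous Φ :=
    (G.contDiff_mul.continuous.comp (continuous_fst.prodMk continuous_const)).prodMk continuous_snd
  have hmem : Φ ⁻¹' U ∈ 𝓝 ((0 : Coord m), b.2) := by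
    refine (hU.preimage hc).mem_nhds ?_
    simpa [hΦ, G.zero_mul] using hb
  obtain ⟨δ, hδ, hball⟩ := Metric.mem_nhds_iff.1 hmem
  refine ⟨min δ 1, lt_min hδ one_pos, fun ρ hρ hρδ z hz => ?_⟩
  have hρ1 : ρ < 1 := hρδ.trans_le (min_le_right _ _)
  have hρ2 : ρ < δ := hρδ.trans_le (min_le_left _ _)
  rw [cylinder_eq_prod] at hz
  obtain ⟨⟨w, hw, hwz⟩, hz2⟩ := hz
  have h1 : ((w, z.2) : Coord m × ℝ) ∈ Metric.ball ((0 : Coord m), b.2) δ := by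
    rw [← ball_prod_same]
    refine ⟨?_, ?_⟩
    · rw [mem_ball_zero_iff]
      exact (norm_le_of_gauge_le hρ hρ1.le (le_of_lt hw)).trans_lt hρ2
    · refine Metric.ball_subset_ball ?_ hz2
      nlinarith
  have h2 := hball h1
  have h3 : Φ (w, z.2) = z := Prod.ext hwz rfl
  rwa [mem_preimage, h3] at h2

/-! ### Radii and diameter -/

theorem pdist_le_pdiam (G : CarnotGroup m) {Ω : Set (Coord m × ℝ)} {a b : Coord m × ℝ}
    (ha : a ∈ Ω) (hb : b ∈ Ω) : ENNReal.ofReal (G.pdist a b) ≤ G.pdiam Ω :=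
  le_iSup₂_of_le a ha (le_iSup₂_of_le b hb le_rfl)

theorem pdist_le_toReal_pdiam (G : CarnotGroup m) {Ω : Set (Coord m × ℝ)} (hΩ : G.pdiam Ω < ⊤)
    {a b : Coord m × ℝ} (ha : a ∈ Ω) (hb : b ∈ Ω) : G.pdist a b ≤ (G.pdiam Ω).toReal :=
  (ENNReal.ofReal_le_iff_le_toReal hΩ.ne).1 (G.pdist_le_pdiam ha hb)

theorem pos_of_mem_radii (G : CarnotGroup m) {R₀ : ℝ≥0∞} {Ω : Set (Coord m × ℝ)} {ρ : ℝ}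
    (h : ρ ∈ G.radii R₀ Ω) : 0 < ρ := h.1

theorem mem_radii_of_le (G : CarnotGroup m) {R₀ : ℝ≥0∞} {Ω : Set (Coord m × ℝ)} {ρ σ : ℝ}
    (h : ρ ∈ G.radii R₀ Ω) (hσ : 0 < σ) (hσρ : σ ≤ ρ) : σ ∈ G.radii R₀ Ω :=
  ⟨hσ, (ENNReal.ofReal_le_ofReal hσρ).trans_lt h.2⟩

/-- An open set contains points with the same space coordinate, hence its diameter is positive. -/
theorem pdiam_pos (G : CarnotGroup m) {Ω : Set (Coord m × ℝ)} (hΩ : IsOpen Ω)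
    {a : Coord m × ℝ} (ha : a ∈ Ω) : 0 < G.pdiam Ω := by
  have hc : Continuous fun s : ℝ => (a.1, a.2 + s) := by fun_prop
  have h : ∀ᶠ s in 𝓝[>] (0 : ℝ), (a.1, a.2 + s) ∈ Ω := by
    refine nhdsWithin_le_nhds ((hΩ.preimage hc).mem_nhds ?_)
    simpa using ha
  obtain ⟨s, hs, hs0⟩ := (h.and self_mem_nhdsWithin).exists
  have hs0' : (0 : ℝ) < s := hs0
  refine lt_of_lt_of_le (ENNReal.ofReal_pos.2 ?_) (G.pdist_le_pdiam ha hs)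
  refine lt_of_le_of_ne (G.pdist_nonneg _ _) fun h0 => ?_
  have := congrArg Prod.snd (G.eq_of_pdist_eq_zero h0.symm)
  simp only at this
  linarith

theorem exists_mem_radii (G : CarnotGroup m) {R₀ : ℝ≥0∞} (hR : 0 < R₀) {Ω : Set (Coord m × ℝ)}
    (hΩ : IsOpen Ω) {a : Coord m × ℝ} (ha : a ∈ Ω) : ∃ ρ, ρ ∈ G.radii R₀ Ω := by
  obtain ⟨x, hx0, hx⟩ := ENNReal.lt_iff_exists_real_btwn.1 (lt_min hR (G.pdiam_pos hΩ ha))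
  exact ⟨x, ENNReal.ofReal_pos.1 hx.1, hx.2⟩

/-- In a set of finite diameter `Δ`, every point outside the cylinder of radius `Δ` about a point
of the set has one of three time coordinates. -/
theorem volume_diff_cylinder_pdiam (G : CarnotGroup m) {Ω : Set (Coord m × ℝ)}
    (hΩ : G.pdiam Ω < ⊤) {a : Coord m × ℝ} (ha : a ∈ Ω) :
    volume (Ω \ G.cylinder (G.pdiam Ω).toReal a) = 0 := by
  set Δ := (G.pdiam Ω).toReal with hΔ
  have hsub : Ω \ G.cylinder Δ a ⊆ univ ×ˢ ({a.2, a.2 - Δ ^ 2, a.2 + Δ ^ 2} : Set ℝ) := by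
    rintro b ⟨hb, hbc⟩
    refine ⟨mem_univ _, ?_⟩
    have h1 : G.pdist a b ^ 2 ≤ Δ ^ 2 :=
      pow_le_pow_left₀ (G.pdist_nonneg _ _) (G.pdist_le_toReal_pdiam hΩ ha hb) 2
    rw [pdist_sq] at h1
    have h2 := G.dist_nonneg a.1 b.1
    have h3 := abs_nonneg (a.2 - b.2)
    simp only [mem_insert_iff, mem_singleton_iff]
    by_cases h4 : |a.2 - b.2| < Δ ^ 2
    · have h5 : Δ ≤ G.dist a.1 b.1 := not_lt.1 fun h => hbc ⟨h4, h⟩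
      have h6 : Δ ^ 2 ≤ G.dist a.1 b.1 ^ 2 := pow_le_pow_left₀ ENNReal.toReal_nonneg h5 2
      have h7 : a.2 - b.2 = 0 := abs_eq_zero.1 (by linarith)
      left
      linarith
    · have h5 : |a.2 - b.2| = Δ ^ 2 := by
        have := sq_nonneg (G.dist a.1 b.1)
        linarith
      right
      rcases (abs_eq (sq_nonneg Δ)).1 h5 with h6 | h6
      · left
        linarith
      · right
        linarith
  refine measure_mono_null hsub ?_
  rw [Measure.volume_eq_prod, Measure.prod_prod,
    (toFinite {a.2, a.2 - Δ ^ 2, a.2 + Δ ^ 2}).measure_zero,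
    MulZeroClass.mul_zero]

theorem subset_cylinder_of_pdiam_lt (G : CarnotGroup m) {Ω : Set (Coord m × ℝ)}
    (hΩ : G.pdiam Ω < ⊤) {a : Coord m × ℝ} (ha : a ∈ Ω) {ρ : ℝ} (hρ : (G.pdiam Ω).toReal < ρ) :
    Ω ⊆ G.cylinder ρ a := fun b hb =>
  (G.mem_cylinder (ENNReal.toReal_nonneg.trans_lt hρ) a b).2
    ((G.cdist_le_pdist a b).trans_lt ((G.pdist_le_toReal_pdiam hΩ ha hb).trans_lt hρ))

/-- Cylinders about `a` of radius close to the diameter of `Ω` contain almost all of `Ω`. -/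
theorem eventually_lt_volume_cylinder_inter (G : CarnotGroup m) {Ω : Set (Coord m × ℝ)}
    (hΩo : IsOpen Ω) (hΩ : G.pdiam Ω < ⊤) {a : Coord m × ℝ} (ha : a ∈ Ω) {V : ℝ≥0∞}
    (hV : V < volume Ω) :
    ∃ σ < (G.pdiam Ω).toReal, ∀ ρ, σ < ρ → V < volume (G.cylinder ρ a ∩ Ω) := by
  set Δ := (G.pdiam Ω).toReal with hΔ
  have hΔ0 : 0 < Δ := ENNReal.toReal_pos (G.pdiam_pos hΩo ha).ne' hΩ.ne
  obtain ⟨s, hsm, hs, hlim⟩ := exists_seq_strictMono_tendsto' hΔ0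
  have hU : G.cylinder Δ a ∩ Ω = ⋃ n, G.cylinder (s n) a ∩ Ω := by
    ext b
    simp only [mem_inter_iff, mem_iUnion, exists_and_right]
    refine and_congr_left fun _ => ⟨fun hb => ?_, fun ⟨n, hn⟩ =>
      G.cylinder_mono (hs n).1 (hs n).2.le a hn⟩
    obtain ⟨n, hn⟩ := (hlim.eventually (lt_mem_nhds ((G.mem_cylinder hΔ0 a b).1 hb))).exists
    exact ⟨n, (G.mem_cylinder (hs n).1 a b).2 hn⟩
  have hmono : Monotone fun n => G.cylinder (s n) a ∩ Ω := fun i j hij =>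
    inter_subset_inter_left _ (G.cylinder_mono (hs i).1 (hsm.monotone hij) a)
  have hfull : volume (G.cylinder Δ a ∩ Ω) = volume Ω := by
    refine le_antisymm (measure_mono inter_subset_right) ?_
    rw [inter_comm, ← measure_inter_add_sdiff Ω (G.isOpen_cylinder hΔ0 a).measurableSet,
      G.volume_diff_cylinder_pdiam hΩ ha, add_zero]
  rw [← hfull, hU] at hV
  obtain ⟨n, hn⟩ := ((tendsto_measure_iUnion_atTop hmono).eventually (lt_mem_nhds hV)).exists
  exact ⟨s n, (hs n).2, fun ρ hρ => hn.trans_le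
    (measure_mono (inter_subset_inter_left _ (G.cylinder_mono (hs n).1 hρ.le a)))⟩

end CarnotGroup

/-! ### Mean oscillation -/

/-- A Campanato bound in `L^p` bounds the mean oscillation about the average, at the cost of a
factor `2`. -/
theorem integral_abs_sub_average_le {X : Type*} [MeasurableSpace X] {ν : Measure X}
    [IsFiniteMeasure ν] [NeZero ν] {p : ℝ≥0∞} (hp : 1 ≤ p) {f : X → ℝ}
    (hf : AEStronglyMeasurable f ν) {k S : ℝ} (hk : 0 < k) (hS : 0 ≤ S)
    (h : ⨅ c : ℝ, ENNReal.ofReal k * eLpNorm (fun x => f x - c) p ((ν univ)⁻¹ • ν) ≤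
      ENNReal.ofReal S) :
    Integrable f ν ∧ ∫ x, |f x - ⨍ y, f y ∂ν| ∂ν ≤ 2 * (S / k) * ν.real univ := by
  set P : Measure X := (ν univ)⁻¹ • ν with hP
  have hPprob : IsProbabilityMeasure P := inferInstance
  have hfP : AEStronglyMeasurable f P := hf.smul_measure _
  have key : ∀ ε : ℝ, 0 < ε → Integrable f P ∧ ∫ x, |f x - ⨍ y, f y ∂ν| ∂P ≤ 2 * ((S + ε) / k) := by
    intro ε hε
    have hlt : ENNReal.ofReal S < ENNReal.ofReal (S + ε) :=
      (ENNReal.ofReal_lt_ofReal_iff (by linarith)).2 (by linarith)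
    obtain ⟨c, hc⟩ := iInf_lt_iff.1 (h.trans_lt hlt)
    have hmeas : AEStronglyMeasurable (fun x => f x - c) P := hfP.sub aestronglyMeasurable_const
    have h1 : ENNReal.ofReal k * eLpNorm (fun x => f x - c) 1 P ≤ ENNReal.ofReal (S + ε) :=
      (mul_le_mul_right (eLpNorm_le_eLpNorm_of_exponent_le hp hmeas) _).trans hc.le
    have h2 : eLpNorm (fun x => f x - c) 1 P ≤ ENNReal.ofReal ((S + ε) / k) := by
      rw [ENNReal.ofReal_div_of_pos hk]
      refine ENNReal.le_div_iff_mul_le (Or.inl (ENNReal.ofReal_pos.2 hk).ne')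
        (Or.inl ENNReal.ofReal_ne_top) |>.2 ?_
      rwa [mul_comm]
    have hint : Integrable (fun x => f x - c) P :=
      memLp_one_iff_integrable.1 ⟨hmeas, h2.trans_lt ENNReal.ofReal_lt_top⟩
    have hintf : Integrable f P := by
      have := hint.add (integrable_const c)
      simpa [Pi.add_def] using this
    have h3 : ∫ x, |f x - c| ∂P ≤ (S + ε) / k := by
      have h4 := ENNReal.toReal_mono ENNReal.ofReal_ne_top h2
      rw [ENNReal.toReal_ofReal (by positivity)] at h4
      rw [eLpNorm_one_eq_lintegral_enorm, ← integral_norm_eq_lintegral_enorm hmeas] at h4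
      exact h4
    have h5 : |c - ⨍ y, f y ∂ν| ≤ (S + ε) / k := by
      have e : c - ⨍ y, f y ∂ν = -∫ x, (f x - c) ∂P := by
        rw [integral_sub hintf (integrable_const c), average]
        simp [hP]
      rw [e, abs_neg]
      exact abs_integral_le_integral_abs.trans h3
    refine ⟨hintf, ?_⟩
    calc ∫ x, |f x - ⨍ y, f y ∂ν| ∂P ≤ ∫ x, (|f x - c| + |c - ⨍ y, f y ∂ν|) ∂P :=
          integral_mono (hintf.sub (integrable_const _)).abs
            (hint.abs.add (integrable_const _)) fun x => abs_sub_le _ _ _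
      _ = ∫ x, |f x - c| ∂P + |c - ⨍ y, f y ∂ν| := by
          rw [integral_add hint.abs (integrable_const _)]
          simp
      _ ≤ 2 * ((S + ε) / k) := by linarith
  have hνP : ν = ν univ • P := by
    rw [hP, smul_smul, ENNReal.mul_inv_cancel (NeZero.ne _) (measure_ne_top ν univ), one_smul]
  have hb : ∫ x, |f x - ⨍ y, f y ∂ν| ∂P ≤ 2 * (S / k) := by
    refine le_of_forall_pos_le_add fun δ hδ => ?_
    have := (key (δ * k / 2) (by positivity)).2
    have e : 2 * ((S + δ * k / 2) / k) = 2 * (S / k) + δ := by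
      field_simp
    rwa [e] at this
  constructor
  · rw [hνP]
    exact (key 1 one_pos).1.smul_measure (measure_ne_top ν univ)
  · have e : ∫ x, |f x - ⨍ y, f y ∂ν| ∂ν =
        ν.real univ * ∫ x, |f x - ⨍ y, f y ∂ν| ∂P := by
      have := integral_smul_measure (μ := P) (fun x => |f x - ⨍ y, f y ∂ν|) (ν univ)
      rw [← hνP] at this
      exact this
    rw [e, mul_comm]
    gcongr

/-- Two constants that are close in mean to the same function on sets with a common part `E` are
close to each other. -/
theorem abs_sub_mul_le_of_integral_abs_sub_le {X : Type*} [MeasurableSpace X] {μ : Measure X}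
    {f : X → ℝ} {E E₁ E₂ : Set X} (hE : μ E ≠ ⊤) (h₁ : E ⊆ E₁) (h₂ : E ⊆ E₂) {c₁ c₂ B₁ B₂ : ℝ}
    (hi₁ : IntegrableOn (fun x => |f x - c₁|) E₁ μ) (hi₂ : IntegrableOn (fun x => |f x - c₂|) E₂ μ)
    (hB₁ : ∫ x in E₁, |f x - c₁| ∂μ ≤ B₁) (hB₂ : ∫ x in E₂, |f x - c₂| ∂μ ≤ B₂) :
    |c₁ - c₂| * μ.real E ≤ B₁ + B₂ := by
  have hc : IntegrableOn (fun _ : X => |c₁ - c₂|) E μ := integrableOn_const hE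
  calc |c₁ - c₂| * μ.real E = ∫ _ in E, |c₁ - c₂| ∂μ := by
        rw [setIntegral_const, smul_eq_mul, mul_comm]
    _ ≤ ∫ x in E, (|f x - c₁| + |f x - c₂|) ∂μ := by
        refine integral_mono hc ((hi₁.mono_set h₁).add (hi₂.mono_set h₂)) fun x => ?_
        have := abs_sub_le c₁ (f x) c₂
        rwa [abs_sub_comm c₁ (f x)] at this
    _ = ∫ x in E, |f x - c₁| ∂μ + ∫ x in E, |f x - c₂| ∂μ :=
        integral_add (hi₁.mono_set h₁) (hi₂.mono_set h₂)
    _ ≤ ∫ x in E₁, |f x - c₁| ∂μ + ∫ x in E₂, |f x - c₂| ∂μ := by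
        refine add_le_add ?_ ?_
        · exact setIntegral_mono_set hi₁ (Eventually.of_forall fun _ => abs_nonneg _)
            h₁.eventuallyLE
        · exact setIntegral_mono_set hi₂ (Eventually.of_forall fun _ => abs_nonneg _)
            h₂.eventuallyLE
    _ ≤ B₁ + B₂ := add_le_add hB₁ hB₂

theorem aestronglyMeasurable_restrict_of_isCompact {X : Type*} [TopologicalSpace X]
    [MeasurableSpace X] [LocallyCompactSpace X] [SecondCountableTopology X]
    {μ : Measure X} {Ω : Set X} (hΩ : IsOpen Ω) {f : X → ℝ}
    (hf : ∀ K ⊆ Ω, IsCompact K → AEStronglyMeasurable f (μ.restrict K)) :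
    AEStronglyMeasurable f (μ.restrict Ω) := by
  have : LocallyCompactSpace Ω := hΩ.locallyCompactSpace
  obtain ⟨K, hK, hU⟩ : IsSigmaCompact Ω := isSigmaCompact_iff_sigmaCompactSpace.2 inferInstance
  rw [← hU, aestronglyMeasurable_iUnion_iff]
  exact fun n => hf (K n) (hU ▸ subset_iUnion K n) (hK n)

namespace CarnotGroup

variable {r : ℕ} {m : Fin r → ℕ}

/-- The mean value of `u` over the part of a cylinder in `Ω`. -/
def mean (G : CarnotGroup m) (Ω : Set (Coord m × ℝ)) (u : Coord m × ℝ → ℝ) (ρ : ℝ)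
    (a : Coord m × ℝ) : ℝ :=
  ⨍ b in G.cylinder ρ a ∩ Ω, u b

/-- The Campanato condition of exponent `1` about the mean values: `u` is integrable on the
cylinders in use, with mean oscillation at most `2 S ρ ^ α`. -/
def HasMeanOscillation (G : CarnotGroup m) (R₀ : ℝ≥0∞) (α S : ℝ) (Ω : Set (Coord m × ℝ))
    (u : Coord m × ℝ → ℝ) : Prop :=
  ∀ a ∈ Ω, ∀ ρ ∈ G.radii R₀ Ω, IntegrableOn u (G.cylinder ρ a ∩ Ω) ∧
    ∫ b in G.cylinder ρ a ∩ Ω, |u b - G.mean Ω u ρ a| ≤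
      2 * S * ρ ^ α * volume.real (G.cylinder ρ a ∩ Ω)

variable {G : CarnotGroup m} {R₀ p : ℝ≥0∞} {α A S : ℝ} {Ω : Set (Coord m × ℝ)}
  {u : Coord m × ℝ → ℝ}

theorem volume_cylinder_inter_lt_top (G : CarnotGroup m) {ρ : ℝ} (hρ : 0 < ρ)
    (a : Coord m × ℝ) (Ω : Set (Coord m × ℝ)) : volume (G.cylinder ρ a ∩ Ω) < ⊤ :=
  (measure_mono inter_subset_left).trans_lt (G.volume_cylinder_lt_top hρ a)

theorem MemCampanato.hasMeanOscillation (hp : 1 ≤ p) (hA : 0 < A) (hΩ : IsOpen Ω)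
    (hAP : G.HasAProperty R₀ A Ω) (hu : G.MemCampanato R₀ p α Ω u) :
    G.HasMeanOscillation R₀ α (G.campanatoSeminorm R₀ p α Ω u).toReal Ω u := by
  intro a ha ρ hρ
  have hρ0 := G.pos_of_mem_radii hρ
  have hpos : 0 < volume (G.cylinder ρ a ∩ Ω) :=
    (ENNReal.mul_pos (ENNReal.ofReal_pos.2 hA).ne' (G.volume_cylinder_pos hρ0 a).ne').trans_le
      (hAP a ha ρ hρ)
  have hlt := G.volume_cylinder_inter_lt_top hρ0 a Ω
  have hmeas : AEStronglyMeasurable u (volume.restrict Ω) :=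
    aestronglyMeasurable_restrict_of_isCompact hΩ fun K hK hKc => (hu.1 K hK hKc).1
  have : IsFiniteMeasure (volume.restrict (G.cylinder ρ a ∩ Ω)) :=
    isFiniteMeasure_restrict.2 hlt.ne
  have : NeZero (volume.restrict (G.cylinder ρ a ∩ Ω)) :=
    ⟨fun h => hpos.ne' (Measure.restrict_eq_zero.1 h)⟩
  have h := integral_abs_sub_average_le (ν := volume.restrict (G.cylinder ρ a ∩ Ω)) hp
    (hmeas.mono_measure (Measure.restrict_mono inter_subset_right le_rfl))
    (k := ρ ^ (-α)) (Real.rpow_pos_of_pos hρ0 _)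
    (S := (G.campanatoSeminorm R₀ p α Ω u).toReal) ENNReal.toReal_nonneg (by
      rw [ENNReal.ofReal_toReal hu.2.ne, Measure.restrict_apply_univ]
      exact le_iSup₂_of_le a ha (le_iSup₂_of_le ρ hρ le_rfl))
  refine ⟨h.1, h.2.trans_eq ?_⟩
  rw [Real.rpow_neg hρ0.le, div_inv_eq_mul, Measure.real, Measure.restrict_apply_univ,
    Measure.real]
  ring

theorem HasAProperty.real_le (hA : 0 < A) (hAP : G.HasAProperty R₀ A Ω) {a : Coord m × ℝ}
    (ha : a ∈ Ω) {ρ : ℝ} (hρ : ρ ∈ G.radii R₀ Ω) :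
    A * volume.real (G.cylinder ρ a) ≤ volume.real (G.cylinder ρ a ∩ Ω) := by
  have h := ENNReal.toReal_mono
    (G.volume_cylinder_inter_lt_top (G.pos_of_mem_radii hρ) a Ω).ne (hAP a ha ρ hρ)
  rwa [ENNReal.toReal_mul, ENNReal.toReal_ofReal hA.le] at h

theorem HasMeanOscillation.integrableOn_abs_sub (hu : G.HasMeanOscillation R₀ α S Ω u)
    {a : Coord m × ℝ} (ha : a ∈ Ω) {ρ : ℝ} (hρ : ρ ∈ G.radii R₀ Ω) (c : ℝ) :
    IntegrableOn (fun b => |u b - c|) (G.cylinder ρ a ∩ Ω) :=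
  ((hu a ha ρ hρ).1.sub (integrableOn_const
    (G.volume_cylinder_inter_lt_top (G.pos_of_mem_radii hρ) a Ω).ne)).abs

/-- Comparison of the means over two cylinders of comparable size, one inside the other. -/
theorem HasMeanOscillation.abs_mean_sub_mean_le (hA : 0 < A) (hS : 0 ≤ S) (hα : 0 < α)
    (hAP : G.HasAProperty R₀ A Ω) (hu : G.HasMeanOscillation R₀ α S Ω u)
    {a b : Coord m × ℝ} (ha : a ∈ Ω) (hb : b ∈ Ω) {σ ρ c : ℝ} (hσ : 0 < σ)
    (hρ : ρ ∈ G.radii R₀ Ω) (hσρ : σ ≤ ρ) (hc : 0 < c) (hρσ : ρ ≤ c * σ)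
    (hsub : G.cylinder σ b ⊆ G.cylinder ρ a) :
    |G.mean Ω u σ b - G.mean Ω u ρ a| ≤ 4 * (scaleConst m c / A) * S * ρ ^ α := by
  have hρ0 := G.pos_of_mem_radii hρ
  have hσr : σ ∈ G.radii R₀ Ω := G.mem_radii_of_le hρ hσ hσρ
  set V := volume.real (G.cylinder σ b ∩ Ω) with hV
  have hVA : A * volume.real (G.cylinder σ b) ≤ V := hAP.real_le hA hb hσr
  have hQ : 0 < volume.real (G.cylinder σ b) :=
    ENNReal.toReal_pos (G.volume_cylinder_pos hσ b).ne' (G.volume_cylinder_lt_top hσ b).ne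
  have hVpos : 0 < V := (mul_pos hA hQ).trans_le hVA
  have hW : volume.real (G.cylinder ρ a ∩ Ω) ≤ scaleConst m c / A * V := by
    calc volume.real (G.cylinder ρ a ∩ Ω) ≤ volume.real (G.cylinder (c * σ) a) :=
          measureReal_mono (inter_subset_left.trans (G.cylinder_mono hρ0 hρσ a))
            (G.volume_cylinder_lt_top (mul_pos hc hσ) a).ne
      _ = scaleConst m c / A * (A * volume.real (G.cylinder σ b)) := by
          rw [G.volume_real_cylinder_mul hc σ a b]
          field_simp
      _ ≤ scaleConst m c / A * V := by
          have := scaleConst_nonneg (m := m) c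
          gcongr
  have hVW : V ≤ volume.real (G.cylinder ρ a ∩ Ω) :=
    measureReal_mono (inter_subset_inter_left _ hsub)
      (G.volume_cylinder_inter_lt_top hρ0 a Ω).ne
  have h := abs_sub_mul_le_of_integral_abs_sub_le
    (G.volume_cylinder_inter_lt_top hσ b Ω).ne subset_rfl
    (inter_subset_inter_left Ω hsub) (hu.integrableOn_abs_sub hb hσr _)
    (hu.integrableOn_abs_sub ha hρ _) (hu b hb σ hσr).2 (hu a ha ρ hρ).2
  have hpow : σ ^ α ≤ ρ ^ α := Real.rpow_le_rpow hσ.le hσρ hα.le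
  have hρα : 0 ≤ ρ ^ α := Real.rpow_nonneg hρ0.le _
  refine le_of_mul_le_mul_right (h.trans ?_) hVpos
  calc 2 * S * σ ^ α * V + 2 * S * ρ ^ α * volume.real (G.cylinder ρ a ∩ Ω)
      ≤ 2 * S * ρ ^ α * volume.real (G.cylinder ρ a ∩ Ω) +
          2 * S * ρ ^ α * volume.real (G.cylinder ρ a ∩ Ω) := by gcongr
    _ = 4 * S * ρ ^ α * volume.real (G.cylinder ρ a ∩ Ω) := by ring
    _ ≤ 4 * S * ρ ^ α * (scaleConst m c / A * V) := by gcongr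
    _ = 4 * (scaleConst m c / A) * S * ρ ^ α * V := by ring

/-- The constant in the estimate of the means by their limit, the sum of a geometric series. -/
def dyadicConst (m : Fin r → ℕ) (α A : ℝ) : ℝ :=
  4 * (scaleConst m 2 / A) / (1 - 2⁻¹ ^ α)

theorem half_rpow_lt_one (hα : 0 < α) : (2⁻¹ : ℝ) ^ α < 1 :=
  Real.rpow_lt_one (by norm_num) (by norm_num) hα

theorem dyadicConst_nonneg (hA : 0 < A) (hα : 0 < α) : 0 ≤ dyadicConst m α A := by
  have h1 := half_rpow_lt_one hα
  have h2 := scaleConst_nonneg (m := m) 2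
  have h3 : 0 ≤ 1 - (2⁻¹ : ℝ) ^ α := by linarith
  unfold dyadicConst
  positivity

theorem HasMeanOscillation.abs_mean_sub_mean_le_of_le (hA : 0 < A) (hS : 0 ≤ S) (hα : 0 < α)
    (hAP : G.HasAProperty R₀ A Ω) (hu : G.HasMeanOscillation R₀ α S Ω u)
    {a : Coord m × ℝ} (ha : a ∈ Ω) {σ ρ : ℝ} (hσ : 0 < σ)
    (hρ : ρ ∈ G.radii R₀ Ω) (hσρ : σ ≤ ρ) :
    |G.mean Ω u σ a - G.mean Ω u ρ a| ≤ dyadicConst m α A * S * ρ ^ α := by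
  set c₀ := 4 * (scaleConst m 2 / A) with hc₀
  have hq := half_rpow_lt_one hα
  have hq0 : (0 : ℝ) ≤ 2⁻¹ ^ α := by positivity
  have hC := dyadicConst_nonneg (m := m) hA hα
  have hCeq : dyadicConst m α A * 2⁻¹ ^ α + c₀ = dyadicConst m α A := by
    have h : 1 - (2⁻¹ : ℝ) ^ α ≠ 0 := by linarith
    rw [dyadicConst, ← hc₀]
    generalize (2⁻¹ : ℝ) ^ α = q at h
    field_simp
    ring
  have hstep : ∀ σ ρ, 0 < σ → ρ ∈ G.radii R₀ Ω → σ ≤ ρ → ρ ≤ 2 * σ →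
      |G.mean Ω u σ a - G.mean Ω u ρ a| ≤ c₀ * S * ρ ^ α := fun σ ρ h1 h2 h3 h4 =>
    hu.abs_mean_sub_mean_le hA hS hα hAP ha ha h1 h2 h3 two_pos h4 (G.cylinder_mono h1 h3 a)
  obtain ⟨n, hn⟩ : ∃ n : ℕ, ρ * 2⁻¹ ^ n < σ := by
    have h := ((tendsto_pow_atTop_nhds_zero_of_lt_one (r := (2⁻¹ : ℝ)) (by norm_num)
      (by norm_num)).const_mul ρ)
    rw [MulZeroClass.mul_zero] at h
    exact (h.eventually (gt_mem_nhds hσ)).exists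
  induction n generalizing ρ with
  | zero =>
    simp only [pow_zero, mul_one] at hn
    linarith
  | succ n ih =>
    have hρ0 := G.pos_of_mem_radii hρ
    by_cases h : ρ ≤ 2 * σ
    · refine (hstep σ ρ hσ hρ hσρ h).trans ?_
      have : c₀ ≤ dyadicConst m α A := by nlinarith
      gcongr
    · push Not at h
      have hhalf : ρ / 2 ∈ G.radii R₀ Ω := G.mem_radii_of_le hρ (by linarith) (by linarith)
      have h1 := ih hhalf (by linarith) (by
        rw [pow_succ] at hn
        linarith)
      have h2 := hstep (ρ / 2) ρ (by linarith) hρ (by linarith) (by linarith)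
      have h3 : (ρ / 2) ^ α = ρ ^ α * 2⁻¹ ^ α := by
        rw [div_eq_mul_inv, Real.mul_rpow hρ0.le (by norm_num)]
      rw [h3] at h1
      calc |G.mean Ω u σ a - G.mean Ω u ρ a|
          ≤ |G.mean Ω u σ a - G.mean Ω u (ρ / 2) a| + |G.mean Ω u (ρ / 2) a - G.mean Ω u ρ a| :=
            abs_sub_le _ _ _
        _ ≤ dyadicConst m α A * S * (ρ ^ α * 2⁻¹ ^ α) + c₀ * S * ρ ^ α := add_le_add h1 h2
        _ = (dyadicConst m α A * 2⁻¹ ^ α + c₀) * S * ρ ^ α := by ring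
        _ = dyadicConst m α A * S * ρ ^ α := by rw [hCeq]

/-- The means over shrinking cylinders converge, with a rate. -/
theorem HasMeanOscillation.exists_limit_mean (hA : 0 < A) (hS : 0 ≤ S) (hα : 0 < α)
    (hAP : G.HasAProperty R₀ A Ω) (hu : G.HasMeanOscillation R₀ α S Ω u)
    {a : Coord m × ℝ} (ha : a ∈ Ω) :
    ∃ y : ℝ, ∀ ρ ∈ G.radii R₀ Ω, |y - G.mean Ω u ρ a| ≤ dyadicConst m α A * S * ρ ^ α := by
  by_cases hne : ∃ ρ₀, ρ₀ ∈ G.radii R₀ Ω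
  swap
  · exact ⟨0, fun ρ hρ => absurd ⟨ρ, hρ⟩ hne⟩
  obtain ⟨ρ₀, hρ₀⟩ := hne
  have hρ₀' := G.pos_of_mem_radii hρ₀
  have hlim : Tendsto (fun n : ℕ => ρ₀ * (2⁻¹ : ℝ) ^ n) atTop (𝓝 0) := by
    simpa using (tendsto_pow_atTop_nhds_zero_of_lt_one (r := (2⁻¹ : ℝ)) (by norm_num)
      (by norm_num)).const_mul ρ₀
  have hpos : ∀ n : ℕ, 0 < ρ₀ * (2⁻¹ : ℝ) ^ n := fun n => by positivity
  have hmem : ∀ n : ℕ, ρ₀ * (2⁻¹ : ℝ) ^ n ∈ G.radii R₀ Ω := fun n =>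
    G.mem_radii_of_le hρ₀ (hpos n)
      (mul_le_of_le_one_right hρ₀'.le (pow_le_one₀ (by norm_num) (by norm_num)))
  have hanti : ∀ {n k : ℕ}, n ≤ k → ρ₀ * (2⁻¹ : ℝ) ^ k ≤ ρ₀ * (2⁻¹ : ℝ) ^ n := fun h =>
    mul_le_mul_of_nonneg_left (pow_le_pow_of_le_one (by norm_num) (by norm_num) h) hρ₀'.le
  have hb : Tendsto (fun n : ℕ => 2 * (dyadicConst m α A * S * (ρ₀ * (2⁻¹ : ℝ) ^ n) ^ α))
      atTop (𝓝 0) := by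
    have h := ((hlim.rpow_const (Or.inr hα.le)).const_mul (dyadicConst m α A * S)).const_mul 2
    simpa [Real.zero_rpow hα.ne'] using h
  have hcs : CauchySeq fun n : ℕ => G.mean Ω u (ρ₀ * (2⁻¹ : ℝ) ^ n) a := by
    refine cauchySeq_of_le_tendsto_0 _ (fun n k N hn hk => ?_) hb
    have h1 := hu.abs_mean_sub_mean_le_of_le hA hS hα hAP ha (hpos n) (hmem N) (hanti hn)
    have h2 := hu.abs_mean_sub_mean_le_of_le hA hS hα hAP ha (hpos k) (hmem N) (hanti hk)
    have h3 := dist_triangle_right (G.mean Ω u (ρ₀ * (2⁻¹ : ℝ) ^ n) a)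
      (G.mean Ω u (ρ₀ * (2⁻¹ : ℝ) ^ k) a) (G.mean Ω u (ρ₀ * (2⁻¹ : ℝ) ^ N) a)
    simp only [Real.dist_eq] at h3 ⊢
    linarith
  obtain ⟨y, hy⟩ := cauchySeq_tendsto_of_complete hcs
  refine ⟨y, fun ρ hρ => ?_⟩
  refine le_of_tendsto (hy.sub_const (G.mean Ω u ρ a)).abs ?_
  filter_upwards [hlim.eventually (gt_mem_nhds (G.pos_of_mem_radii hρ))] with n hn
  exact hu.abs_mean_sub_mean_le_of_le hA hS hα hAP ha (hpos n) hρ (le_of_lt hn)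

/-! ### The Hölder estimate -/

/-- The constant in the Hölder estimate: two steps from a value to a mean, and one comparison of
means, with the summand `4 (…)` for nested cylinders and `8` for cylinders that fill most of the set.
The last factor converts the radius `2 K d` to the distance `d`. -/
def holderConst (G : CarnotGroup m) (α A : ℝ) : ℝ :=
  (2 * dyadicConst m α A + 4 * (scaleConst m (2 * G.quasiConst) / A) + 8) *
    (2 * G.quasiConst) ^ α

theorem holderConst_nonneg (hA : 0 < A) (hα : 0 < α) : 0 ≤ G.holderConst α A := by
  have h1 := dyadicConst_nonneg (m := m) hA hα
  have h2 := scaleConst_nonneg (m := m) (2 * G.quasiConst)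
  have h3 := G.one_le_quasiConst
  unfold holderConst
  positivity

/-- If the diameter of `Ω` is finite and at most `R₀`, the means over cylinders about any two points
of `Ω` of radius near the diameter are close, since such cylinders fill most of `Ω`. -/
theorem HasMeanOscillation.exists_radius_abs_mean_sub_mean_le (hS : 0 ≤ S)
    (hΩo : IsOpen Ω) (hΩ : G.pdiam Ω < ⊤) (hR : G.pdiam Ω ≤ R₀)
    (hu : G.HasMeanOscillation R₀ α S Ω u)
    {a b : Coord m × ℝ} (ha : a ∈ Ω) (hb : b ∈ Ω) :
    ∃ ρ ∈ G.radii R₀ Ω, |G.mean Ω u ρ a - G.mean Ω u ρ b| ≤ 8 * S * ρ ^ α := by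
  set Δ := (G.pdiam Ω).toReal with hΔ
  have hΔ0 : 0 < Δ := ENNReal.toReal_pos (G.pdiam_pos hΩo ha).ne' hΩ.ne
  have hVt : volume Ω < ⊤ :=
    (measure_mono (G.subset_cylinder_of_pdiam_lt hΩ ha (ρ := 2 * Δ) (by linarith))).trans_lt
      (G.volume_cylinder_lt_top (by linarith) a)
  have hV0 : 0 < volume Ω := hΩo.measure_pos volume ⟨a, ha⟩
  set V := volume.real Ω with hV
  have hVpos : 0 < V := ENNReal.toReal_pos hV0.ne' hVt.ne
  have hlt : ENNReal.ofReal (3 / 4 * V) < volume Ω := by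
    rw [← ofReal_measureReal hVt.ne]
    exact (ENNReal.ofReal_lt_ofReal_iff hVpos).2 (by linarith)
  obtain ⟨σ₁, hσ₁, h₁⟩ := G.eventually_lt_volume_cylinder_inter hΩo hΩ ha hlt
  obtain ⟨σ₂, hσ₂, h₂⟩ := G.eventually_lt_volume_cylinder_inter hΩo hΩ hb hlt
  obtain ⟨ρ, hρ1, hρ2⟩ := exists_between (max_lt (max_lt hσ₁ hσ₂) hΔ0)
  obtain ⟨hρ3, hρ0⟩ := max_lt_iff.1 hρ1
  have hρ : ρ ∈ G.radii R₀ Ω := by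
    refine ⟨hρ0, ?_⟩
    rw [min_eq_right hR]
    exact (ENNReal.ofReal_lt_iff_lt_toReal hρ0.le hΩ.ne).2 hρ2
  refine ⟨ρ, hρ, ?_⟩
  set E₁ := G.cylinder ρ a ∩ Ω with hE₁
  set E₂ := G.cylinder ρ b ∩ Ω with hE₂
  have hm₂ : MeasurableSet E₂ := ((G.isOpen_cylinder hρ0 b).inter hΩo).measurableSet
  have hV₁ : 3 / 4 * V ≤ volume.real E₁ :=
    (ENNReal.ofReal_le_iff_le_toReal (G.volume_cylinder_inter_lt_top hρ0 a Ω).ne).1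
      (h₁ ρ ((le_max_left _ _).trans_lt hρ3)).le
  have hV₂ : 3 / 4 * V ≤ volume.real E₂ :=
    (ENNReal.ofReal_le_iff_le_toReal (G.volume_cylinder_inter_lt_top hρ0 b Ω).ne).1
      (h₂ ρ ((le_max_right _ _).trans_lt hρ3)).le
  have hE₁V : volume.real E₁ ≤ V := measureReal_mono inter_subset_right hVt.ne
  have hE₂V : volume.real E₂ ≤ V := measureReal_mono inter_subset_right hVt.ne
  have hinter : 1 / 2 * V ≤ volume.real (E₁ ∩ E₂) := by
    have e := measureReal_union_add_inter (μ := volume) (s := E₁) (t := E₂) hm₂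
      (G.volume_cylinder_inter_lt_top hρ0 a Ω).ne (G.volume_cylinder_inter_lt_top hρ0 b Ω).ne
    have hle : volume.real (E₁ ∪ E₂) ≤ V :=
      measureReal_mono (union_subset inter_subset_right inter_subset_right) hVt.ne
    linarith
  have h := abs_sub_mul_le_of_integral_abs_sub_le (E := E₁ ∩ E₂)
    ((measure_mono (inter_subset_left.trans inter_subset_right)).trans_lt hVt).ne
    inter_subset_left inter_subset_right (hu.integrableOn_abs_sub ha hρ _)
    (hu.integrableOn_abs_sub hb hρ _) (hu a ha ρ hρ).2 (hu b hb ρ hρ).2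
  have hρα : 0 ≤ ρ ^ α := Real.rpow_nonneg hρ0.le _
  refine le_of_mul_le_mul_right (a := 1 / 2 * V) ?_ (by positivity)
  calc |G.mean Ω u ρ a - G.mean Ω u ρ b| * (1 / 2 * V)
      ≤ |G.mean Ω u ρ a - G.mean Ω u ρ b| * volume.real (E₁ ∩ E₂) := by gcongr
    _ ≤ 2 * S * ρ ^ α * volume.real E₁ + 2 * S * ρ ^ α * volume.real E₂ := h
    _ ≤ 2 * S * ρ ^ α * V + 2 * S * ρ ^ α * V := by gcongr
    _ = 8 * S * ρ ^ α * (1 / 2 * V) := by ring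

/-- The limit of the means is Hölder continuous. With `K` the quasi-triangle constant, the cylinder
of radius `d = pdist a b` about `b` lies in that of radius `2 K d` about `a`. If `2 K d` is not
among the radii in use, then the diameter of `Ω` is at most `2 K d`, and the means are compared at
a radius near the diameter. -/
theorem HasMeanOscillation.holder_estimate (hA : 0 < A) (hS : 0 ≤ S) (hα : 0 < α) (hΩo : IsOpen Ω)
    (hAP : G.HasAProperty R₀ A Ω) (hu : G.HasMeanOscillation R₀ α S Ω u)
    {v : Coord m × ℝ → ℝ} (hv : ∀ a ∈ Ω, ∀ ρ ∈ G.radii R₀ Ω,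
      |v a - G.mean Ω u ρ a| ≤ dyadicConst m α A * S * ρ ^ α)
    {a b : Coord m × ℝ} (ha : a ∈ Ω) (hb : b ∈ Ω)
    (hab : ENNReal.ofReal (2 * G.quasiConst * G.pdist a b) < R₀) :
    |v a - v b| ≤ G.holderConst α A * S * G.pdist a b ^ α := by
  have hK := G.one_le_quasiConst
  set d := G.pdist a b with hd
  rcases (G.pdist_nonneg a b).eq_or_lt with h0 | hd0
  · have : a = b := G.eq_of_pdist_eq_zero h0.symm
    rw [this, sub_self, abs_zero]
    have := holderConst_nonneg (G := G) hA hα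
    have := Real.rpow_nonneg (G.pdist_nonneg a b) α
    positivity
  rw [← hd] at hd0
  set ρ := 2 * G.quasiConst * d with hρ
  have hdρ : d ≤ ρ := by nlinarith
  have hρα : ρ ^ α = (2 * G.quasiConst) ^ α * d ^ α := Real.mul_rpow (by positivity) hd0.le
  set D := scaleConst m (2 * G.quasiConst) / A with hD
  have hDnn : 0 ≤ D := div_nonneg (scaleConst_nonneg _) hA.le
  have hC := dyadicConst_nonneg (m := m) hA hα
  have hfin : |v a - v b| ≤ (2 * dyadicConst m α A + 4 * D + 8) * S * ρ ^ α := by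
    by_cases hdiam : ENNReal.ofReal ρ < G.pdiam Ω
    · have hρr : ρ ∈ G.radii R₀ Ω := ⟨hd0.trans_le hdρ, lt_min hab hdiam⟩
      have hsub : G.cylinder d b ⊆ G.cylinder ρ a := by
        intro z hz
        rw [mem_cylinder _ hd0] at hz
        rw [mem_cylinder _ (hd0.trans_le hdρ)]
        calc G.cdist a z ≤ G.quasiConst * (G.cdist a b + G.cdist b z) := G.cdist_triangle a b z
          _ < G.quasiConst * (d + d) := by
              have := G.cdist_le_pdist a b
              have h2 : G.cdist a b + G.cdist b z < d + d := by linarith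
              exact mul_lt_mul_of_pos_left h2 (by linarith)
          _ = ρ := by rw [hρ]; ring
      have h1 := hv a ha ρ hρr
      have h2 := hv b hb d (G.mem_radii_of_le hρr hd0 hdρ)
      have h3 := hu.abs_mean_sub_mean_le hA hS hα hAP ha hb hd0 hρr hdρ
        (by positivity : 0 < 2 * G.quasiConst) le_rfl hsub
      rw [← hD] at h3
      have h4 : d ^ α ≤ ρ ^ α := Real.rpow_le_rpow hd0.le hdρ hα.le
      have h5 : dyadicConst m α A * S * d ^ α ≤ dyadicConst m α A * S * ρ ^ α := by gcongr
      have h6 := abs_sub_le (v a) (G.mean Ω u ρ a) (v b)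
      have h7 := abs_sub_le (G.mean Ω u ρ a) (G.mean Ω u d b) (v b)
      rw [abs_sub_comm (G.mean Ω u ρ a) (G.mean Ω u d b)] at h7
      rw [abs_sub_comm (G.mean Ω u d b) (v b)] at h7
      have h8 : 0 ≤ S * ρ ^ α := by positivity
      linarith
    · rw [not_lt] at hdiam
      have hΩt : G.pdiam Ω < ⊤ := hdiam.trans_lt ENNReal.ofReal_lt_top
      obtain ⟨σ, hσ, h3⟩ := hu.exists_radius_abs_mean_sub_mean_le hS hΩo hΩt
        (hdiam.trans hab.le) ha hb
      have hσ0 := G.pos_of_mem_radii hσ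
      have hσρ : σ ≤ ρ := by
        have h := (hσ.2.trans_le (min_le_right _ _)).trans_le hdiam
        exact ((ENNReal.ofReal_lt_ofReal_iff (hd0.trans_le hdρ)).1 h).le
      have h1 := hv a ha σ hσ
      have h2 := hv b hb σ hσ
      have h4 : σ ^ α ≤ ρ ^ α := Real.rpow_le_rpow hσ0.le hσρ hα.le
      have h6 := abs_sub_le (v a) (G.mean Ω u σ a) (v b)
      have h7 := abs_sub_le (G.mean Ω u σ a) (G.mean Ω u σ b) (v b)
      rw [abs_sub_comm (G.mean Ω u σ b) (v b)] at h7
      calc |v a - v b| ≤ (2 * dyadicConst m α A + 8) * S * σ ^ α := by linarith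
        _ ≤ (2 * dyadicConst m α A + 4 * D + 8) * S * ρ ^ α := by
            gcongr
            linarith
  calc |v a - v b| ≤ (2 * dyadicConst m α A + 4 * D + 8) * S * ρ ^ α := hfin
    _ = G.holderConst α A * S * d ^ α := by
        rw [hρα, holderConst]
        ring

/-! ### The limit of the means is the given function -/

/-- The double integral of `w b` over the pairs of points `a ∈ U` and `b` at `cdist` less than `ρ`,
taken in the two orders. -/
theorem lintegral_mul_volume_cylinder_inter_le (G : CarnotGroup m) {U : Set (Coord m × ℝ)}
    {w : Coord m × ℝ → ℝ≥0∞} (hw : Measurable w) {ρ : ℝ}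
    (hρ : 0 < ρ) (hU : MeasurableSet U) {e : ℝ≥0∞}
    (h : ∀ a ∈ U, ∫⁻ b in G.cylinder ρ a, w b ≤ e) :
    Measurable (fun b => w b * volume (G.cylinder ρ b ∩ U)) ∧
      ∫⁻ b, w b * volume (G.cylinder ρ b ∩ U) ≤ e * volume U := by
  classical
  set F : Coord m × ℝ → Coord m × ℝ → ℝ≥0∞ := fun a => (G.cylinder ρ a).indicator w with hF
  have hsymm : ∀ a b, a ∈ G.cylinder ρ b ↔ b ∈ G.cylinder ρ a := by
    intro a b
    rw [mem_cylinder _ hρ, mem_cylinder _ hρ, cdist_comm]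
  have hFm : Measurable (Function.uncurry F) := by
    have hT : IsOpen {q : (Coord m × ℝ) × (Coord m × ℝ) | G.cdist q.1 q.2 < ρ} :=
      isOpen_lt G.continuous_cdist continuous_const
    have hFT : Function.uncurry F =
        {q : (Coord m × ℝ) × (Coord m × ℝ) | G.cdist q.1 q.2 < ρ}.indicator
          fun q => w q.2 := by
      ext q
      change (G.cylinder ρ q.1).indicator w q.2 = _
      rw [indicator_apply, indicator_apply]
      simp only [mem_cylinder _ hρ, mem_ofPred_eq]
    rw [hFT]
    exact (hw.comp measurable_snd).indicator hT.measurableSet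
  have h2 : ∀ b, (fun a => F a b) = (G.cylinder ρ b).indicator fun _ => w b := by
    intro b
    ext a
    change (G.cylinder ρ a).indicator w b = _
    rw [indicator_apply, indicator_apply]
    simp only [hsymm a b]
  have h3 : ∀ b, ∫⁻ a in U, F a b = w b * volume (G.cylinder ρ b ∩ U) := by
    intro b
    rw [h2 b, lintegral_indicator_const (G.isOpen_cylinder hρ b).measurableSet,
      Measure.restrict_apply (G.isOpen_cylinder hρ b).measurableSet]
  have h4 : ∀ a ∈ U, ∫⁻ b, F a b ≤ e := by
    intro a ha
    rw [hF, lintegral_indicator (G.isOpen_cylinder hρ a).measurableSet]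
    exact h a ha
  simp only [← h3]
  refine ⟨hFm.lintegral_prod_left (μ := volume.restrict U), ?_⟩
  rw [← lintegral_lintegral_swap (μ := volume.restrict U) (ν := volume) hFm.aemeasurable]
  calc ∫⁻ a in U, ∫⁻ b, F a b ≤ ∫⁻ _ in U, e := setLIntegral_mono' hU h4
    _ = e * volume U := by rw [setLIntegral_const]

/-- A nonnegative function whose means over the cylinders about all points of an open set tend
uniformly to zero with the radius vanishes there almost everywhere. By Fubini's theorem and Fatou's
lemma, without a differentiation theorem. -/
theorem ae_eq_zero_of_setLIntegral_cylinder_le (G : CarnotGroup m) {Ω : Set (Coord m × ℝ)}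
    (hΩ : IsOpen Ω) {w : Coord m × ℝ → ℝ≥0∞} (hw : AEMeasurable w (volume.restrict Ω))
    {ρ₀ : ℝ} (hρ₀ : 0 < ρ₀) {ε : ℝ → ℝ≥0∞} (hε : Tendsto ε (𝓝[>] 0) (𝓝 0))
    (h : ∀ a ∈ Ω, ∀ ρ, 0 < ρ → ρ < ρ₀ →
      ∫⁻ b in G.cylinder ρ a ∩ Ω, w b ≤ ε ρ * volume (G.cylinder ρ a)) :
    w =ᵐ[volume.restrict Ω] 0 := by
  have hind : AEMeasurable (Ω.indicator w) volume :=
    (aemeasurable_indicator_iff hΩ.measurableSet).2 hw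
  obtain ⟨W, hWm, hW⟩ := hind
  have hWcyl : ∀ a ∈ Ω, ∀ ρ, 0 < ρ → ρ < ρ₀ →
      ∫⁻ b in G.cylinder ρ a, W b ≤ ε ρ * volume (G.cylinder ρ (0 : Coord m × ℝ)) := by
    intro a ha ρ h1 h2
    rw [← lintegral_congr_ae (ae_restrict_of_ae hW), lintegral_indicator hΩ.measurableSet,
      Measure.restrict_restrict hΩ.measurableSet, inter_comm]
    refine (h a ha ρ h1 h2).trans_eq ?_
    rw [volume_cylinder, volume_cylinder]
  set ρ : ℕ → ℝ := fun n => ρ₀ / (n + 2) with hρ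
  have hρpos : ∀ n, 0 < ρ n := fun n => by positivity
  have hρlt : ∀ n, ρ n < ρ₀ := fun n => div_lt_self hρ₀ (by
    have : (0 : ℝ) ≤ n := Nat.cast_nonneg n
    linarith)
  have hρlim : Tendsto ρ atTop (𝓝 0) :=
    Tendsto.const_div_atTop (tendsto_atTop_add_const_right _ _ tendsto_natCast_atTop_atTop) _
  have hρlim' : Tendsto ρ atTop (𝓝[>] 0) :=
    tendsto_nhdsWithin_iff.2 ⟨hρlim, Eventually.of_forall hρpos⟩
  -- the claim on open subsets of finite measure
  have key : ∀ U ⊆ Ω, IsOpen U → volume U < ⊤ → ∫⁻ b in U, W b = 0 := by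
    intro U hUΩ hU hUt
    set V : ℕ → ℝ≥0∞ := fun n => volume (G.cylinder (ρ n) (0 : Coord m × ℝ)) with hV
    have hV0 : ∀ n, V n ≠ 0 := fun n => (G.volume_cylinder_pos (hρpos n) 0).ne'
    have hVt : ∀ n, V n ≠ ⊤ := fun n => (G.volume_cylinder_lt_top (hρpos n) 0).ne
    have hF := fun n => G.lintegral_mul_volume_cylinder_inter_le hWm (hρpos n) hU.measurableSet
      fun a ha => hWcyl a (hUΩ ha) (ρ n) (hρpos n) (hρlt n)
    set g : ℕ → Coord m × ℝ → ℝ≥0∞ := fun n b =>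
      (V n)⁻¹ * (W b * volume (G.cylinder (ρ n) b ∩ U)) with hg
    have hgm : ∀ n, Measurable (g n) := fun n => (hF n).1.const_mul _
    have hgint : ∀ n, ∫⁻ b in U, g n b ≤ ε (ρ n) * volume U := by
      intro n
      calc ∫⁻ b in U, g n b ≤ ∫⁻ b, g n b := setLIntegral_le_lintegral _ _
        _ = (V n)⁻¹ * ∫⁻ b, W b * volume (G.cylinder (ρ n) b ∩ U) :=
            lintegral_const_mul _ (hF n).1
        _ ≤ (V n)⁻¹ * (ε (ρ n) * V n * volume U) := by gcongr; exact (hF n).2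
        _ = (V n)⁻¹ * V n * (ε (ρ n) * volume U) := by ring
        _ = ε (ρ n) * volume U := by rw [ENNReal.inv_mul_cancel (hV0 n) (hVt n), one_mul]
    have hglim : ∀ b ∈ U, W b ≤ liminf (fun n => g n b) atTop := by
      intro b hb
      obtain ⟨δ, hδ, hsub⟩ := G.exists_cylinder_subset hU hb
      have hev : ∀ᶠ n in atTop, g n b = W b := by
        filter_upwards [hρlim.eventually (gt_mem_nhds hδ)] with n hn
        have hVn : volume (G.cylinder (ρ n) b ∩ U) = V n := by
          rw [inter_eq_left.2 (hsub (ρ n) (hρpos n) hn), hV]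
          simp only [volume_cylinder]
        simp only [hg]
        rw [hVn, mul_comm (W b), ← _root_.mul_assoc, ENNReal.inv_mul_cancel (hV0 n) (hVt n),
          one_mul]
      exact ((tendsto_const_nhds.congr' (hev.mono fun _ h => h.symm)).liminf_eq).ge
    have hlim0 : Tendsto (fun n => ε (ρ n) * volume U) atTop (𝓝 0) := by
      have := ENNReal.Tendsto.mul_const (hε.comp hρlim') (b := volume U) (Or.inr hUt.ne)
      rwa [MulZeroClass.zero_mul] at this
    refine le_antisymm ?_ bot_le
    calc ∫⁻ b in U, W b ≤ ∫⁻ b in U, liminf (fun n => g n b) atTop :=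
          setLIntegral_mono' hU.measurableSet hglim
      _ ≤ liminf (fun n => ∫⁻ b in U, g n b) atTop := lintegral_liminf_le hgm
      _ ≤ liminf (fun n => ε (ρ n) * volume U) atTop :=
          liminf_le_liminf (Eventually.of_forall hgint)
      _ = 0 := hlim0.liminf_eq
  have hcover : Ω = ⋃ n : ℕ, Ω ∩ Metric.ball (0 : Coord m × ℝ) n := by
    rw [← inter_iUnion, Metric.iUnion_ball_nat, inter_univ]
  have hW0 : ∀ᵐ b ∂volume.restrict Ω, W b = 0 := by
    rw [hcover, ae_restrict_iUnion_iff]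
    intro n
    have h0 := key _ inter_subset_left (hΩ.inter Metric.isOpen_ball)
      ((measure_mono inter_subset_right).trans_lt
        (measure_ball_lt_top (x := (0 : Coord m × ℝ)) (r := n)))
    exact (lintegral_eq_zero_iff hWm).1 h0
  filter_upwards [hW0, ae_restrict_of_ae hW, ae_restrict_mem hΩ.measurableSet] with b h1 h2 h3
  rw [indicator_of_mem h3, h1] at h2
  exact h2

variable {G : CarnotGroup m} {R₀ : ℝ≥0∞} {α A S L η : ℝ} {Ω : Set (Coord m × ℝ)}
  {u v : Coord m × ℝ → ℝ}

theorem continuousOn_of_abs_sub_le (hα : 0 < α) (hη : 0 < η)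
    (hv : ∀ a ∈ Ω, ∀ b ∈ Ω, G.pdist a b < η → |v a - v b| ≤ L * G.pdist a b ^ α) :
    ContinuousOn v Ω := by
  intro a ha
  have hc : Tendsto (fun b => G.pdist b a) (𝓝[Ω] a) (𝓝 0) := by
    have := (G.continuous_pdist.comp₂ continuous_id (continuous_const (y := a))).tendsto a
    simp only [id, pdist_self] at this
    exact this.mono_left nhdsWithin_le_nhds
  have hlim : Tendsto (fun b => L * G.pdist b a ^ α) (𝓝[Ω] a) (𝓝 0) := by
    have := (hc.rpow_const (Or.inr hα.le)).const_mul L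
    rwa [Real.zero_rpow hα.ne', MulZeroClass.mul_zero] at this
  refine tendsto_iff_dist_tendsto_zero.2 (squeeze_zero' (Eventually.of_forall fun _ =>
    _root_.dist_nonneg) ?_ hlim)
  filter_upwards [hc.eventually (gt_mem_nhds hη), self_mem_nhdsWithin] with b hb hbΩ
  exact hv b hbΩ a ha hb

theorem HasMeanOscillation.ae_eq (hA : 0 < A) (hS : 0 ≤ S) (hα : 0 < α) (hΩ : IsOpen Ω)
    (hR : 0 < R₀) (hmeas : AEStronglyMeasurable u (volume.restrict Ω))
    (hu : G.HasMeanOscillation R₀ α S Ω u)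
    (hvm : ∀ a ∈ Ω, ∀ ρ ∈ G.radii R₀ Ω,
      |v a - G.mean Ω u ρ a| ≤ dyadicConst m α A * S * ρ ^ α) (hL : 0 ≤ L) (hη : 0 < η)
    (hv : ∀ a ∈ Ω, ∀ b ∈ Ω, G.pdist a b < η → |v a - v b| ≤ L * G.pdist a b ^ α) :
    v =ᵐ[volume.restrict Ω] u := by
  rcases Ω.eq_empty_or_nonempty with rfl | ⟨a₀, ha₀⟩
  · simp [Filter.EventuallyEq]
  obtain ⟨ρ₁, hρ₁⟩ := G.exists_mem_radii hR hΩ ha₀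
  have hC := dyadicConst_nonneg (m := m) hA hα
  have hvmeas : AEStronglyMeasurable v (volume.restrict Ω) :=
    (continuousOn_of_abs_sub_le hα hη hv).aestronglyMeasurable hΩ.measurableSet
  set e : ℝ → ℝ := fun ρ => 2 * S * ρ ^ α + (dyadicConst m α A * S * ρ ^ α + L * (2 * ρ) ^ α)
    with he
  have helim : Tendsto (fun ρ => ENNReal.ofReal (e ρ)) (𝓝[>] 0) (𝓝 0) := by
    have hid : Tendsto (fun ρ : ℝ => ρ) (𝓝[>] 0) (𝓝 0) := tendsto_id.mono_left nhdsWithin_le_nhds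
    have h1 : Tendsto (fun ρ : ℝ => ρ ^ α) (𝓝[>] 0) (𝓝 0) := by
      have := hid.rpow_const (p := α) (Or.inr hα.le)
      rwa [Real.zero_rpow hα.ne'] at this
    have h2 : Tendsto (fun ρ : ℝ => (2 * ρ) ^ α) (𝓝[>] 0) (𝓝 0) := by
      have := (hid.const_mul 2).rpow_const (p := α) (Or.inr hα.le)
      rwa [MulZeroClass.mul_zero, Real.zero_rpow hα.ne'] at this
    have h3 := (h1.const_mul (2 * S)).add
      ((h1.const_mul (dyadicConst m α A * S)).add (h2.const_mul L))
    simp only [MulZeroClass.mul_zero, add_zero] at h3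
    have := ENNReal.tendsto_ofReal h3
    rwa [ENNReal.ofReal_zero] at this
  have h0 := G.ae_eq_zero_of_setLIntegral_cylinder_le hΩ
    (w := fun b => ENNReal.ofReal |u b - v b|)
    (hmeas.aemeasurable.sub hvmeas.aemeasurable).abs.ennreal_ofReal
    (ρ₀ := min ρ₁ (η / 2)) (lt_min (G.pos_of_mem_radii hρ₁) (half_pos hη)) helim ?_
  · filter_upwards [h0] with b hb
    have h1 : |u b - v b| ≤ 0 := ENNReal.ofReal_eq_zero.1 hb
    have h2 := abs_eq_zero.1 (le_antisymm h1 (abs_nonneg _))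
    linarith
  · intro a ha ρ hρ hρlt
    have hρr : ρ ∈ G.radii R₀ Ω :=
      G.mem_radii_of_le hρ₁ hρ (hρlt.le.trans (min_le_left _ _))
    have hρη : ρ < η / 2 := hρlt.trans_le (min_le_right _ _)
    set c := dyadicConst m α A * S * ρ ^ α + L * (2 * ρ) ^ α with hc
    have hc0 : 0 ≤ c := by positivity
    set Q := G.cylinder ρ a ∩ Ω with hQ
    have hQm : MeasurableSet Q := ((G.isOpen_cylinder hρ a).inter hΩ).measurableSet
    have hQt : volume Q < ⊤ := G.volume_cylinder_inter_lt_top hρ a Ω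
    have hpt : ∀ b ∈ Q, ENNReal.ofReal |u b - v b| ≤
        ENNReal.ofReal (|u b - G.mean Ω u ρ a| + c) := by
      rintro b ⟨hb, hbΩ⟩
      refine ENNReal.ofReal_le_ofReal ?_
      have hd : G.pdist a b ≤ 2 * ρ := (G.pdist_le_two_mul_cdist a b).trans
        (by linarith [(G.mem_cylinder hρ a b).1 hb])
      have h1 := hv a ha b hbΩ (by linarith)
      have h2 := hvm a ha ρ hρr
      have h3 : L * G.pdist a b ^ α ≤ L * (2 * ρ) ^ α := by
        have := Real.rpow_le_rpow (G.pdist_nonneg a b) hd hα.le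
        gcongr
      have h4 := abs_sub_le (u b) (G.mean Ω u ρ a) (v b)
      have h5 := abs_sub_le (G.mean Ω u ρ a) (v a) (v b)
      rw [abs_sub_comm (G.mean Ω u ρ a) (v a)] at h5
      linarith
    have hint := hu.integrableOn_abs_sub ha hρr (G.mean Ω u ρ a)
    calc ∫⁻ b in Q, ENNReal.ofReal |u b - v b|
        ≤ ∫⁻ b in Q, ENNReal.ofReal (|u b - G.mean Ω u ρ a| + c) :=
          setLIntegral_mono' hQm hpt
      _ = ENNReal.ofReal (∫ b in Q, (|u b - G.mean Ω u ρ a| + c)) :=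
          (ofReal_integral_eq_lintegral_ofReal (hint.add (integrableOn_const hQt.ne))
            (Eventually.of_forall fun b => add_nonneg (abs_nonneg _) hc0)).symm
      _ ≤ ENNReal.ofReal (e ρ * volume.real Q) := by
          refine ENNReal.ofReal_le_ofReal ?_
          rw [integral_add hint (integrableOn_const hQt.ne), setIntegral_const, smul_eq_mul]
          have := (hu a ha ρ hρr).2
          calc _ ≤ 2 * S * ρ ^ α * volume.real Q + volume.real Q * c := by gcongr
            _ = e ρ * volume.real Q := by
                rw [he]
                ring
      _ = ENNReal.ofReal (e ρ) * volume Q := by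
          rw [ENNReal.ofReal_mul (by positivity), ofReal_measureReal hQt.ne]
      _ ≤ ENNReal.ofReal (e ρ) * volume (G.cylinder ρ a) := by
          gcongr
          exact inter_subset_left

/-! ### Global Hölder bounds -/

theorem memHolder_of_abs_sub_le (hL : 0 ≤ L)
    (hv : ∀ a ∈ Ω, ∀ b ∈ Ω, |v a - v b| ≤ L * G.pdist a b ^ α) : G.MemHolder α Ω v := by
  refine ⟨L.toNNReal, fun a ha => iSup₂_le fun b hb => iSup_le fun _ => ?_⟩
  refine ENNReal.ofReal_le_ofReal (div_le_of_le_mul₀ (Real.rpow_nonneg (G.pdist_nonneg _ _) _) hL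
    (hv b hb a ha))

/-- A locally Hölder function, with uniform constants, on a set of finite diameter is bounded,
because the set is relatively compact. -/
theorem exists_abs_le_of_pdiam_lt_top (hα : 0 < α) (hΩ : G.pdiam Ω < ⊤) (hL : 0 ≤ L) (hη : 0 < η)
    (hv : ∀ a ∈ Ω, ∀ b ∈ Ω, G.pdist a b < η → |v a - v b| ≤ L * G.pdist a b ^ α) :
    ∃ B : ℝ, ∀ a ∈ Ω, |v a| ≤ B := by
  rcases Ω.eq_empty_or_nonempty with rfl | ⟨a₀, ha₀⟩
  · exact ⟨0, fun a ha => absurd ha (notMem_empty a)⟩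
  obtain ⟨K, hK, hsub⟩ := G.exists_isCompact_cylinder_subset
    (ρ := (G.pdiam Ω).toReal + 1) (by positivity) a₀
  have hΩK : Ω ⊆ K := (G.subset_cylinder_of_pdiam_lt hΩ ha₀ (by linarith)).trans hsub
  suffices h : ∃ B : ℝ, ∀ a ∈ K ∩ Ω, |v a| ≤ B by
    obtain ⟨B, hB⟩ := h
    exact ⟨B, fun a ha => hB a ⟨hΩK ha, ha⟩⟩
  refine hK.induction_on (p := fun s => ∃ B : ℝ, ∀ a ∈ s ∩ Ω, |v a| ≤ B)
    ⟨0, fun a ha => absurd ha.1 (notMem_empty a)⟩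
    (fun s t hst ⟨B, hB⟩ => ⟨B, fun a ha => hB a ⟨hst ha.1, ha.2⟩⟩) ?_ ?_
  · rintro s t ⟨B, hB⟩ ⟨B', hB'⟩
    refine ⟨max B B', ?_⟩
    rintro a ⟨ha | ha, haΩ⟩
    · exact (hB a ⟨ha, haΩ⟩).trans (le_max_left _ _)
    · exact (hB' a ⟨ha, haΩ⟩).trans (le_max_right _ _)
  · intro x _
    have hU : IsOpen {q : (Coord m × ℝ) × (Coord m × ℝ) | G.pdist q.1 q.2 < η} :=
      isOpen_lt G.continuous_pdist continuous_const
    have hxx : {q : (Coord m × ℝ) × (Coord m × ℝ) | G.pdist q.1 q.2 < η} ∈ 𝓝 x ×ˢ 𝓝 x := by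
      rw [← nhds_prod_eq]
      refine hU.mem_nhds ?_
      rw [mem_ofPred_eq, pdist_self]
      exact hη
    obtain ⟨s, hs, hss⟩ := mem_prod_same_iff.1 hxx
    refine ⟨s, nhdsWithin_le_nhds hs, ?_⟩
    rcases (s ∩ Ω).eq_empty_or_nonempty with h | ⟨y, hys, hyΩ⟩
    · exact ⟨0, fun a ha => absurd (h ▸ ha) (notMem_empty a)⟩
    · refine ⟨|v y| + L * η ^ α, ?_⟩
      rintro a ⟨has, haΩ⟩
      have hay : (a, y) ∈ s ×ˢ s := ⟨has, hys⟩
      have hd : G.pdist a y < η := by simpa using hss hay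
      have h1 := hv a haΩ y hyΩ hd
      have h2 := Real.rpow_le_rpow (G.pdist_nonneg a y) hd.le hα.le
      have h3 : L * G.pdist a y ^ α ≤ L * η ^ α := by gcongr
      have h4 := abs_sub_abs_le_abs_sub (v a) (v y)
      linarith

theorem memHolder_of_pdiam_lt_top (hα : 0 < α) (hΩ : G.pdiam Ω < ⊤) (hL : 0 ≤ L) (hη : 0 < η)
    (hv : ∀ a ∈ Ω, ∀ b ∈ Ω, G.pdist a b < η → |v a - v b| ≤ L * G.pdist a b ^ α) :
    G.MemHolder α Ω v := by
  obtain ⟨B, hB⟩ := exists_abs_le_of_pdiam_lt_top hα hΩ hL hη hv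
  have hηα : 0 < η ^ α := Real.rpow_pos_of_pos hη α
  refine memHolder_of_abs_sub_le (L := max L (2 * B / η ^ α)) (hL.trans (le_max_left _ _))
    fun a ha b hb => ?_
  have hd := Real.rpow_nonneg (G.pdist_nonneg a b) α
  by_cases h : G.pdist a b < η
  · refine (hv a ha b hb h).trans ?_
    gcongr
    exact le_max_left _ _
  · have h1 : η ^ α ≤ G.pdist a b ^ α := Real.rpow_le_rpow hη.le (not_lt.1 h) hα.le
    have hB0 : 0 ≤ B := (abs_nonneg _).trans (hB a ha)
    calc |v a - v b| ≤ |v a| + |v b| := abs_sub _ _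
      _ ≤ 2 * B := by linarith [hB a ha, hB b hb]
      _ = 2 * B / η ^ α * η ^ α := by field_simp
      _ ≤ max L (2 * B / η ^ α) * G.pdist a b ^ α := by
          gcongr
          exact le_max_right _ _

end CarnotGroup

end

theorem mainTheorem8 {r : ℕ} {m : Fin r → ℕ} (G : CarnotGroup m)
    (p : ℝ≥0∞) (hp : 1 ≤ p) (α : ℝ) (hα₀ : 0 < α) (hα₁ : α < 1) (A : ℝ) (hA : 0 < A) :
    ∃ (κ : ℝ) (C : ℝ≥0), 0 < κ ∧
      ∀ (R₀ : ℝ≥0∞) (Ω : Set (Coord m × ℝ)), 0 < R₀ → IsOpen Ω → G.HasAProperty R₀ A Ω →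
        ∀ u : Coord m × ℝ → ℝ, G.MemCampanato R₀ p α Ω u →
          ∃ v : Coord m × ℝ → ℝ, v =ᵐ[volume.restrict Ω] u ∧
            (R₀ = ⊤ ∨ G.pdiam Ω < ⊤ → G.MemHolder α Ω v) ∧
            ∀ a ∈ Ω, ∀ b ∈ Ω, ENNReal.ofReal (G.pdist a b) < ENNReal.ofReal κ * R₀ →
              ENNReal.ofReal |v a - v b| ≤
                C * G.campanatoSeminorm R₀ p α Ω u * ENNReal.ofReal (G.pdist a b ^ α) := by
  have hK : 0 < 2 * G.quasiConst := by linarith [G.one_le_quasiConst]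
  have hH := CarnotGroup.holderConst_nonneg (G := G) hA hα₀
  refine ⟨(2 * G.quasiConst)⁻¹, (G.holderConst α A).toNNReal, inv_pos.2 hK,
    fun R₀ Ω hR hΩ hAP u hu => ?_⟩
  set S := (G.campanatoSeminorm R₀ p α Ω u).toReal with hS
  have hS0 : 0 ≤ S := ENNReal.toReal_nonneg
  have hosc : G.HasMeanOscillation R₀ α S Ω u := hu.hasMeanOscillation hp hA hΩ hAP
  have hmeas : AEStronglyMeasurable u (volume.restrict Ω) :=
    aestronglyMeasurable_restrict_of_isCompact hΩ fun K hK hKc => (hu.1 K hK hKc).1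
  choose! v hv using fun a (ha : a ∈ Ω) => hosc.exists_limit_mean hA hS0 hα₀ hAP ha
  have hL : 0 ≤ G.holderConst α A * S := mul_nonneg hH hS0
  have hκ : ∀ a b, ENNReal.ofReal (G.pdist a b) < ENNReal.ofReal (2 * G.quasiConst)⁻¹ * R₀ →
      ENNReal.ofReal (2 * G.quasiConst * G.pdist a b) < R₀ := by
    intro a b h
    have h1 : ENNReal.ofReal (2 * G.quasiConst) ≠ 0 := (ENNReal.ofReal_pos.2 hK).ne'
    rw [ENNReal.ofReal_mul hK.le]
    rw [ENNReal.ofReal_inv_of_pos hK, mul_comm, ← div_eq_mul_inv] at h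
    rw [mul_comm]
    exact (ENNReal.lt_div_iff_mul_lt (Or.inl h1) (Or.inl ENNReal.ofReal_ne_top)).1 h
  have hest : ∀ a ∈ Ω, ∀ b ∈ Ω, ENNReal.ofReal (2 * G.quasiConst * G.pdist a b) < R₀ →
      |v a - v b| ≤ G.holderConst α A * S * G.pdist a b ^ α := fun a ha b hb h =>
    hosc.holder_estimate hA hS0 hα₀ hΩ hAP hv ha hb h
  obtain ⟨η, hη, hηR⟩ : ∃ η : ℝ, 0 < η ∧ ENNReal.ofReal (2 * G.quasiConst * η) ≤ R₀ := by
    obtain ⟨x, hx0, hx⟩ := ENNReal.lt_iff_exists_real_btwn.1 hR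
    have hxpos : 0 < x := ENNReal.ofReal_pos.1 hx.1
    refine ⟨x / (2 * G.quasiConst), by positivity, ?_⟩
    rw [mul_div_cancel₀ _ hK.ne']
    exact hx.2.le
  have hloc : ∀ a ∈ Ω, ∀ b ∈ Ω, G.pdist a b < η →
      |v a - v b| ≤ G.holderConst α A * S * G.pdist a b ^ α := by
    intro a ha b hb h
    refine hest a ha b hb (lt_of_lt_of_le ?_ hηR)
    exact (ENNReal.ofReal_lt_ofReal_iff (by positivity)).2 (mul_lt_mul_of_pos_left h hK)
  refine ⟨v, hosc.ae_eq hA hS0 hα₀ hΩ hR hmeas hv hL hη hloc, ?_, fun a ha b hb h => ?_⟩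
  · rintro (rfl | hdiam)
    · exact CarnotGroup.memHolder_of_abs_sub_le hL fun a ha b hb =>
        hest a ha b hb ENNReal.ofReal_lt_top
    · exact CarnotGroup.memHolder_of_pdiam_lt_top hα₀ hdiam hL hη hloc
  · refine (ENNReal.ofReal_le_ofReal (hest a ha b hb (hκ a b h))).trans_eq ?_
    rw [ENNReal.ofReal_mul hL, ENNReal.ofReal_mul hH, hS, ENNReal.ofReal_toReal hu.2.ne]
    rfl
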